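/- **Theorem.** The nonemptiness problem for $\exists^*\forall^*$-syncCFHG is undecidable: there is no algorithm that, given an $\exists^*\forall^*$ synchronous (ranked) context-free hypergrammar $G$, decides whether $\mathfrak L(G)\neq\emptyset$. *Hypergrammars.* A context-free hypergrammar (CFHG) is a tuple $G=\langle\Sigma,X,V,V_0,P,\alpha\rangle$ with $\Sigma$ a finite alphabet not containing the symbol $\#$, $X=\{x_1,\dots,x_k\}$ a finite set of word variables, $\alpha=\mathbb Q_1x_1\cdots\mathbb Q_kx_k$ with $\mathbb Q_i\in\{\exists,\forall\}$, and $\hat G=\langle\hat\Sigma,V,V_0,P\rangle$ a context-free grammar (with finite sets $V$, $P$) over $\hat\Sigma=(\Sigma\cup\{\#\})^X$. It is an $\exists^*\forall^*$-CFHG if $\alpha$ is a (possibly empty) block of $\exists$'s followed by a (possibly empty) block of $\forall$'s. *Semantics.* For $w\in\Sigma^*$ let $w\uparrow_\#$ be the set of all words obtained from $w$ by inserting $\#$-symbols at arbitrary places. For $u:X\to(\Sigma\cup\{\#\})^*$ let $\boldsymbol w_u\in\hat\Sigma^*$ be the word of length $\max_x|u(x)|$ whose $i$-th letter maps $x$ to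 the $i$-th letter of $u(x)$, or to $\#$ if $i>|u(x)|$. For a language $\mathcal L\subseteq\Sigma^*$ put $\mathcal L\vdash_u(\varepsilon,\hat G)$ iff $\boldsymbol w_u\in\mathcal L(\hat G)$; $\mathcal L\vdash_u(\exists x.\alpha',\hat G)$ iff there are $w\in\mathcal L$ and $w_\#\in w\uparrow_\#$ with $\mathcal L\vdash_{u[x\mapsto w_\#]}(\alpha',\hat G)$; and $\mathcal L\vdash_u(\forall x.\alpha',\hat G)$ iff for every $w\in\mathcal L$ there is $w_\#\in w\uparrow_\#$ with $\mathcal L\vdash_{u[x\mapsto w_\#]}(\alpha',\hat G)$. The hyperlanguage $\mathfrak L(G)$ is the set of all nonempty languages $\mathcal L$ with $\mathcal L\vdash_u(\alpha,\hat G)$ (this does not depend on $u$). *Synchronous hypergrammars.* Grammars are assumed reduced: every variable is reachable from $V_0$ and derives a terminal word, and there is no rule $v\to\varepsilon$ except possibly $V_0\to\varepsilon$, in which case $V_0$ occurs in no right-hand side. The rank of a letter $\hat\sigma\in\hat\Sigma$ is $t(\hat\sigma)=\{x\in X\mid\hat\sigma(x)=\#\}$. The rule graph has as vertices the variables and the right-hand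 sides of rules; its left (right) edges go from $v$ to $\gamma$ for every rule $v\to\gamma$, and from every right-hand side to its first (last) symbol if this is a variable. For a letter, $\mathbf L(\hat\sigma)=\mathbf R(\hat\sigma)=t(\hat\sigma)$. For a variable $v$, $\mathbf L(v)$ is the intersection of $t(\hat\sigma)$ over all right-hand sides $\hat\sigma\gamma$ ($\hat\sigma\in\hat\Sigma$) reachable from $v$ along left edges, and $\mathbf R(v)$ is the union of $t(\hat\sigma)$ over all right-hand sides $\gamma\hat\sigma$ reachable from $v$ along right edges. $G$ is ranked (a syncCFHG) if $\mathbf R(\gamma_i)\subseteq\mathbf L(\gamma_{i+1})$ for every rule $v\to\gamma_1\cdots\gamma_n$ and every $1\le i<n$. -/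

import Mathlib

/-- The two quantifiers over word variables. -/
inductive Quantifier where
  | ex
  | all

/-- A context-free hypergrammar with alphabet `Σ = {0, …, numLetters - 1}`, word variables
`X = {0, …, numWordVars - 1}`, grammar variables `V = {0, …, numVars - 1}` and quantification
condition `quant 0 x₀ ⋯ quant (k-1) x_{k-1}`. The underlying rules are over the alphabet
`X → Σ ∪ {#}`, where `#` is `none`. -/
structure CFHG where
  numLetters : ℕ
  numWordVars : ℕ
  numVars : ℕ
  quant : Fin numWordVars → Quantifier
  start : Fin numVars
  rules : List (ContextFreeRule (Fin numWordVars → Option (Fin numLetters)) (Fin numVars))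

namespace CFHG

/-- The alphabet `(Σ ∪ {#})^X` of the underlying grammar. -/
abbrev Letter (G : CFHG) : Type := Fin G.numWordVars → Option (Fin G.numLetters)

/-- Letters and grammar variables. -/
abbrev Sym (G : CFHG) : Type := Symbol G.Letter (Fin G.numVars)

/-- The underlying context-free grammar. -/
def underlying (G : CFHG) : ContextFreeGrammar G.Letter where
  NT := Fin G.numVars
  initial := G.start
  rules := G.rules.toFinset

/-! ### Semantics -/

/-- The words obtained from `w` by inserting `#`-symbols at arbitrary places. -/
def paddings {A : Type} (w : List A) : Set (List (Option A)) := {w' | w'.reduceOption = w}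

/-- The word assignment of `u`: its `i`-th letter collects the `i`-th letters of the words `u x`,
the shorter words being padded with `#` at the end up to the maximal length. -/
def wordAssignment {A : Type} {k : ℕ} (u : Fin k → List (Option A)) :
    List (Fin k → Option A) :=
  List.ofFn fun (i : Fin (Finset.univ.sup fun x => (u x).length)) =>
    fun x => ((u x)[(i : ℕ)]?).getD none

/-- Satisfaction of a quantification condition (a list of quantified word variables) by the
language `L` under the assignment `u`. -/
def Sat (G : CFHG) (L : Language (Fin G.numLetters)) :
    List (Quantifier × Fin G.numWordVars) →
      (Fin G.numWordVars → List (Option (Fin G.numLetters))) → Prop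
  | [], u => wordAssignment u ∈ G.underlying.language
  | (.ex, x) :: α, u => ∃ w ∈ L, ∃ w' ∈ paddings w, Sat G L α (Function.update u x w')
  | (.all, x) :: α, u => ∀ w ∈ L, ∃ w' ∈ paddings w, Sat G L α (Function.update u x w')

/-- The quantification condition as a list of quantified word variables. -/
def condition (G : CFHG) : List (Quantifier × Fin G.numWordVars) :=
  List.ofFn fun x => (G.quant x, x)

/-- The hyperlanguage of `G`: the nonempty languages that `G` derives. Every word variable is
quantified, so the initial assignment is irrelevant. -/
def hyperlanguage (G : CFHG) : Set (Language (Fin G.numLetters)) :=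
  {L | (∃ w, w ∈ L) ∧ G.Sat L G.condition fun _ => []}

/-- The quantification condition is a block of `∃` followed by a block of `∀`. -/
def IsExistsForall (G : CFHG) : Prop :=
  ∃ p q : ℕ, List.ofFn G.quant = List.replicate p .ex ++ List.replicate q .all

/-! ### Synchronous (ranked) hypergrammars -/

/-- The standing assumptions on the underlying grammar: every variable derives a terminal word
and is reachable, and the only empty rule is possibly one for the initial variable, which then
occurs in no right-hand side. -/
structure IsReduced (G : CFHG) : Prop where
  productive : ∀ v : Fin G.numVars, ∃ w : List G.Letter,
    G.underlying.Derives [Symbol.nonterminal v] (w.map Symbol.terminal)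
  reachable : ∀ v : Fin G.numVars, ∃ β γ : List G.Sym,
    G.underlying.Derives [Symbol.nonterminal G.start] (β ++ [Symbol.nonterminal v] ++ γ)
  empty_rule : ∀ r ∈ G.rules, r.output = [] → r.input = G.start ∧
    ∀ r' ∈ G.rules, Symbol.nonterminal G.start ∉ r'.output

/-- The left edges of the rule graph, whose vertices are the variables `v` (as the sequence `[v]`)
and the right-hand sides of the rules. -/
inductive EdgeL (G : CFHG) : List G.Sym → List G.Sym → Prop
  | rule (r) (hr : r ∈ G.rules) : EdgeL G [Symbol.nonterminal r.input] r.output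
  | first (r) (hr : r ∈ G.rules) (v : Fin G.numVars) (γ : List G.Sym)
      (h : r.output = Symbol.nonterminal v :: γ) : EdgeL G r.output [Symbol.nonterminal v]

/-- The right edges of the rule graph. -/
inductive EdgeR (G : CFHG) : List G.Sym → List G.Sym → Prop
  | rule (r) (hr : r ∈ G.rules) : EdgeR G [Symbol.nonterminal r.input] r.output
  | last (r) (hr : r ∈ G.rules) (v : Fin G.numVars) (γ : List G.Sym)
      (h : r.output = γ ++ [Symbol.nonterminal v]) : EdgeR G r.output [Symbol.nonterminal v]

/-- The rank of a letter: the word variables to which it assigns `#`. -/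
def letterRank (G : CFHG) (σ : G.Letter) : Set (Fin G.numWordVars) := {x | σ x = none}

/-- The left rank of a sequence: the intersection of the ranks of the first letters of all
sequences beginning with a letter that are reachable along left edges. (This is what the
propagation of ranks along the strongly connected components, in reverse topological order,
computes.) -/
def leftRank (G : CFHG) (u : List G.Sym) : Set (Fin G.numWordVars) :=
  ⋂ (σ : G.Letter) (γ : List G.Sym)
    (_ : Relation.ReflTransGen G.EdgeL u (Symbol.terminal σ :: γ)), G.letterRank σ

/-- The right rank of a sequence: the union of the ranks of the last letters of all sequences
ending in a letter that are reachable along right edges. -/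
def rightRank (G : CFHG) (u : List G.Sym) : Set (Fin G.numWordVars) :=
  ⋃ (σ : G.Letter) (γ : List G.Sym)
    (_ : Relation.ReflTransGen G.EdgeR u (γ ++ [Symbol.terminal σ])), G.letterRank σ

/-- In every right-hand side `γ₁ ⋯ γₙ`, the right rank of `γᵢ` is contained in the left rank of
`γᵢ₊₁`. -/
def IsRanked (G : CFHG) : Prop :=
  ∀ r ∈ G.rules, r.output.IsChain fun a b => G.rightRank [a] ⊆ G.leftRank [b]

/-- Synchronous context-free hypergrammars. -/
def IsSync (G : CFHG) : Prop := G.IsReduced ∧ G.IsRanked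

/-! ### Hypergrammars as inputs of algorithms -/

/-- Concrete descriptions of hypergrammars: the number of letters, the number of grammar
variables, the quantifiers (`true` for `∀`), the initial variable, and the list of rules. -/
abbrev Code : Type :=
  ℕ × ℕ × List Bool × ℕ × List (ℕ × List (List (Option ℕ) ⊕ ℕ))

def quantCode : Quantifier → Bool
  | .ex => false
  | .all => true

def symCode {m k n : ℕ} : Symbol (Fin k → Option (Fin m)) (Fin n) → List (Option ℕ) ⊕ ℕ
  | .terminal σ => .inl (List.ofFn fun x => (σ x).map Fin.val)
  | .nonterminal v => .inr v

def ruleCode {m k n : ℕ} (r : ContextFreeRule (Fin k → Option (Fin m)) (Fin n)) :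
    ℕ × List (List (Option ℕ) ⊕ ℕ) :=
  (r.input, r.output.map symCode)

/-- The description of a hypergrammar that is given to an algorithm. -/
def encode (G : CFHG) : Code :=
  (G.numLetters, G.numVars, List.ofFn fun x => quantCode (G.quant x), G.start,
    G.rules.map ruleCode)

theorem quantCode_injective : Function.Injective quantCode := by
  rintro (_ | _) (_ | _) h <;> simp_all [quantCode]

theorem symCode_injective {m k n : ℕ} : Function.Injective (@symCode m k n) := by
  rintro (σ | v) (τ | w) h
  · simp only [symCode, Sum.inl.injEq] at h
    have h' := List.ofFn_injective h
    congr 1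
    funext x
    exact Option.map_injective Fin.val_injective (congrFun h' x)
  · simp [symCode] at h
  · simp [symCode] at h
  · simp only [symCode, Sum.inr.injEq] at h
    rw [Fin.val_injective h]

theorem ruleCode_injective {m k n : ℕ} : Function.Injective (@ruleCode m k n) := by
  rintro ⟨i, o⟩ ⟨i', o'⟩ h
  simp only [ruleCode, Prod.mk.injEq] at h
  rw [Fin.val_injective h.1, List.map_injective_iff.2 symCode_injective h.2]

/-- Different hypergrammars have different descriptions. -/
theorem encode_injective : Function.Injective encode := by
  rintro ⟨m, k, n, q, s, P⟩ ⟨m', k', n', q', s', P'⟩ h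
  simp only [encode, Prod.mk.injEq] at h
  obtain ⟨rfl, rfl, hq, hs, hP⟩ := h
  obtain rfl : k = k' := by simpa using congrArg List.length hq
  have hq' : q = q' := by
    funext x
    exact quantCode_injective (congrFun (List.ofFn_injective hq) x)
  rw [hq', Fin.val_injective hs, List.map_injective_iff.2 ruleCode_injective hP]

/-- The problem `Q`, for inputs from the class `C` of hypergrammars, is decidable: some algorithm
halts with the right answer on the description of each member of `C`; nothing is asked of it on
other inputs. -/
def DecidableOn (C : Set CFHG) (Q : CFHG → Prop) : Prop :=
  ∃ f : Code →. Bool, Partrec f ∧ ∀ G ∈ C, ∃ b ∈ f G.encode, (b = true ↔ Q G)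

end CFHG

/-! The halting problem reduces to nonemptiness. A single nondeterministic counter program `P`
accepts exactly the numbers `n` coding a machine that halts on input `0` (`exists_prog_of_partrec`),
where accepting means reaching the all-zero state from the state with `n` in register `0`. A run of
`P` is a word of counter actions subject to finitely many conditions: it must be a trace of the
control structure of `P`, preceded by `n` increments, and each register, taken alone, must go from
`0` to `0` (`run_zero_iff`). Each condition is context-free, since one register is one pushdown
counter. Hence acceptance says that finitely many context-free languages have a common word.

An `∃*∀` hypergrammar expresses such an intersection with one existential variable per condition and
a single universal variable. In every derived tuple all components carry the same trace `u`. The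
existential variable `j` always starts with its own mark `j`, while the universal variable starts
with the mark of the condition that the grammar chose to check. The existential words lie in the
language, so the universal variable must run through them. On the word with mark `j` the grammar is
forced to check condition `j`, and the existential words, being fixed, force the same `u` every
time. Conversely, the marked copies of a common `u` form a derived language
(`nonempty_hyperlanguage_iff`).

No letter of the grammar contains `#`. Therefore padding plays no role, all ranks of letters are
empty, and the hypergrammar is ranked for trivial reasons. Only one rule depends on `n`, so the
reduction is computable. -/

open Function

/-! ### Counter programs and their deterministic runs -/

/-- The actions of a counter machine with registers `ι`: increment, decrement (of a positive
register) and test for zero. -/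
inductive CounterAct (ι : Type) where
  | inc (i : ι)
  | dec (i : ι)
  | zero (i : ι)

namespace CounterAct

/-- The effect of an action on the contents of the register `i`. -/
def Upd {ι : Type} [DecidableEq ι] (i : ι) : CounterAct ι → ℕ → ℕ → Prop
  | inc j, c, d => d = if j = i then c + 1 else c
  | dec j, c, d => c = if j = i then d + 1 else d
  | zero j, c, d => d = c ∧ (j = i → c = 0)

end CounterAct

/-- Nondeterministic counter programs; `loop i P` runs `P` any number of times and then tests
that the register `i` is zero. -/
inductive CounterProg (ι : Type) where
  | act (a : CounterAct ι)
  | seq (P Q : CounterProg ι)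
  | loop (i : ι) (P : CounterProg ι)

namespace CounterProg

variable {ι : Type} [DecidableEq ι]

/-- The input-output relation of a program. -/
def Run : CounterProg ι → (ι → ℕ) → (ι → ℕ) → Prop
  | act a, s, s' => ∀ i, a.Upd i (s i) (s' i)
  | seq P Q, s, s' => ∃ t, Run P s t ∧ Run Q t s'
  | loop i P, s, s' => Relation.ReflTransGen (Run P) s s' ∧ s' i = 0

/-- The only possible result of the program `P` in the state `s` is `t`, and it is possible. -/
def RunsTo (P : CounterProg ι) (s t : ι → ℕ) : Prop := ∀ s', P.Run s s' ↔ s' = t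

theorem RunsTo.seq {P Q : CounterProg ι} {s t u : ι → ℕ} (hP : P.RunsTo s t)
    (hQ : Q.RunsTo t u) : (P.seq Q).RunsTo s u := by
  intro s'
  simp [Run, hP _, hQ _]

theorem runsTo_inc (s : ι → ℕ) (i : ι) : (act (.inc i)).RunsTo s (update s i (s i + 1)) := by
  intro s'
  simp only [Run, CounterAct.Upd, funext_iff, update_apply]
  refine forall_congr' fun j => ?_
  by_cases h : i = j <;> simp [h, eq_comm]

theorem runsTo_dec {s : ι → ℕ} {i : ι} (h : s i ≠ 0) :
    (act (.dec i)).RunsTo s (update s i (s i - 1)) := by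
  intro s'
  simp only [Run, CounterAct.Upd, funext_iff, update_apply]
  refine forall_congr' fun j => ?_
  by_cases hj : i = j
  · subst hj
    simp only [if_true]
    omega
  · simp [hj, Ne.symm hj, eq_comm]

/-- Blocking at zero is what makes loops deterministic: a body that begins with a decrement of the
tested register cannot be entered once that register is zero, and the loop cannot be left before. -/
theorem not_run_dec {s s' : ι → ℕ} {i : ι} (h : s i = 0) : ¬ (act (.dec i)).Run s s' := by
  intro H
  have := H i
  simp [CounterAct.Upd, h] at this

theorem not_run_seq_dec {s s' : ι → ℕ} {i : ι} (Q : CounterProg ι) (h : s i = 0) :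
    ¬ ((act (.dec i)).seq Q).Run s s' := by
  rintro ⟨t, ht, -⟩
  exact not_run_dec h ht

theorem runsTo_zero {s : ι → ℕ} {i : ι} (h : s i = 0) : (act (.zero i)).RunsTo s s := by
  intro s'
  simp only [Run, CounterAct.Upd, funext_iff]
  refine forall_congr' fun j => ?_
  constructor
  · exact fun h => h.1
  · rintro h'
    exact ⟨h', fun hj => hj ▸ h⟩

/-- A loop whose iterations follow the chain `σ` until the tested register is zero. -/
theorem runsTo_loop {P : CounterProg ι} {i : ι} (σ : ℕ → ι → ℕ) (N : ℕ)
    (hpos : ∀ k < N, σ k i ≠ 0) (hN : σ N i = 0) (hstep : ∀ k < N, P.RunsTo (σ k) (σ (k + 1)))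
    (hlast : ∀ t, ¬ P.Run (σ N) t) : (loop i P).RunsTo (σ 0) (σ N) := by
  -- Induction on the number `m` of iterations that remain. Before the end the loop cannot stop, at
  -- the end it cannot continue.
  have key : ∀ m k, k + m = N → ∀ t, Relation.ReflTransGen P.Run (σ k) t ∧ t i = 0 ↔ t = σ N := by
    intro m
    induction m with
    | zero =>
      rintro k rfl t
      rw [add_zero, Relation.ReflTransGen.cases_head_iff]
      constructor
      · rintro ⟨h | ⟨t', h, -⟩, -⟩
        · exact h.symm
        · exact absurd h (hlast _)
      · rintro rfl
        exact ⟨.inl rfl, hN⟩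
    | succ m ih =>
      intro k hk t
      rw [← ih (k + 1) (by omega) t, Relation.ReflTransGen.cases_head_iff]
      constructor
      · rintro ⟨rfl | ⟨t', h, h'⟩, h0⟩
        · exact absurd h0 (hpos k (by omega))
        · rw [hstep k (by omega)] at h
          exact ⟨h ▸ h', h0⟩
      · rintro ⟨h, h0⟩
        exact ⟨.inr ⟨_, (hstep k (by omega) _).2 rfl, h⟩, h0⟩
  exact fun t => key N 0 (by omega) t

/-- A loop whose iterations follow a chain on which the tested register is never zero. -/
theorem not_run_loop {P : CounterProg ι} {i : ι} (σ : ℕ → ι → ℕ) (hpos : ∀ k, σ k i ≠ 0)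
    (hstep : ∀ k, P.RunsTo (σ k) (σ (k + 1))) (t : ι → ℕ) : ¬ (loop i P).Run (σ 0) t := by
  rintro ⟨h, h0⟩
  obtain ⟨k, rfl⟩ : ∃ k, t = σ k := by
    clear h0
    induction h with
    | refl => exact ⟨0, rfl⟩
    | tail _ hbc ih =>
      obtain ⟨k, rfl⟩ := ih
      exact ⟨k + 1, (hstep k _).1 hbc⟩
  exact hpos k h0

/-- Set a register to zero. -/
def clear (i : ι) : CounterProg ι := loop i (act (.dec i))

theorem runsTo_clear (s : ι → ℕ) (i : ι) : (clear i).RunsTo s (update s i 0) := by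
  have := runsTo_loop (P := act (.dec i)) (i := i) (fun k => update s i (s i - k)) (s i)
    (by intro k hk; simp; omega) (by simp)
    (by
      intro k hk
      convert runsTo_dec (s := update s i (s i - k)) (i := i) (by simp; omega) using 1
      simp [Nat.sub_sub])
    (fun t => not_run_dec (by simp))
  simpa [clear] using this

/-- Add the register `i` to the register `o`, with the help of the register `t`. -/
def copy (i o t : ι) : CounterProg ι :=
  (loop i ((act (.dec i)).seq ((act (.inc t)).seq (act (.inc o))))).seq
    (loop t ((act (.dec t)).seq (act (.inc i))))

/-- The first loop moves `i` into both `t` and `o`, the second moves `t` back to `i`. The chains of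
states below are the loop invariants after `k` iterations. -/
theorem runsTo_copy {s : ι → ℕ} {i o t : ι} (hio : i ≠ o) (hit : i ≠ t) (hot : o ≠ t)
    (ho : s o = 0) (ht : s t = 0) : (copy i o t).RunsTo s (update s o (s i)) := by
  refine RunsTo.seq (t := update (update (update s i 0) t (s i)) o (s i)) ?_ ?_
  · have := runsTo_loop (P := (act (.dec i)).seq ((act (.inc t)).seq (act (.inc o)))) (i := i)
      (fun k => update (update (update s i (s i - k)) t k) o k) (s i)
      (by intro k hk; simp [hio, hit]; omega) (by simp [hio, hit])
      (by
        intro k hk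
        have h := ((runsTo_dec (s := update (update (update s i (s i - k)) t k) o k) (i := i)
          (by simp [hio, hit]; omega)).seq ((runsTo_inc _ t).seq (runsTo_inc _ o)))
        convert h using 1
        funext j
        simp only [update_apply]
        split_ifs <;> (simp_all; try omega))
      (fun u => not_run_seq_dec _ (by simp [hio, hit]))
    convert this using 1
    · funext j
      simp only [update_apply]
      split_ifs <;> simp_all
    · simp
  · have := runsTo_loop (P := (act (.dec t)).seq (act (.inc i))) (i := t)
      (fun k => update (update (update s i k) t (s i - k)) o (s i)) (s i)
      (by intro k hk; simp [hot.symm]; omega) (by simp [hot.symm])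
      (by
        intro k hk
        have h := ((runsTo_dec (s := update (update (update s i k) t (s i - k)) o (s i)) (i := t)
          (by simp [hot.symm]; omega)).seq (runsTo_inc _ i))
        convert h using 1
        funext j
        simp only [update_apply]
        split_ifs <;> (simp_all; try omega))
      (fun u => not_run_seq_dec _ (by simp [hot.symm]))
    convert this using 1
    · simp
    · funext j
      simp only [update_apply]
      split_ifs <;> simp_all

/-! ### Programs for partial recursive functions -/

/-- The partial function `f` is computed by counter programs, for any choice of input registers
`a`, output register `o`, and bound `b` from which on the registers may be used as auxiliary
ones. -/
def Implements {n : ℕ} (f : List.Vector ℕ n →. ℕ) : Prop :=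
  ∀ (a : Fin n → ℕ) (o b : ℕ), (∀ i, a i < b) → (∀ i, a i ≠ o) → o < b →
    ∃ P : CounterProg ℕ, ∀ s : ℕ → ℕ, s o = 0 → (∀ j, b ≤ j → s j = 0) →
      ∀ s', P.Run s s' ↔ ∃ y ∈ f (List.Vector.ofFn fun i => s (a i)), s' = update s o y

/-- Writing of the values `y` of a family of partial functions to the registers from `b` on. -/
theorem exists_prog_write {n m : ℕ} {g : Fin m → List.Vector ℕ n →. ℕ}
    (hg : ∀ i, Implements (g i)) (a : Fin n → ℕ) (b : ℕ) (ha : ∀ i, a i < b) (k : ℕ)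
    (hk : k ≤ m) :
    ∃ P : CounterProg ℕ, ∀ s : ℕ → ℕ, (∀ j, b ≤ j → s j = 0) → ∀ s', P.Run s s' ↔
      ∃ y : ℕ → ℕ, (∀ i : Fin m, (i : ℕ) < k → y i ∈ g i (List.Vector.ofFn fun i => s (a i))) ∧
        s' = fun j => if b ≤ j ∧ j < b + k then y (j - b) else s j := by
  induction k with
  | zero =>
    -- A successful zero test serves as the program that does nothing.
    refine ⟨act (.zero b), fun s hs s' => ?_⟩
    rw [runsTo_zero (hs b le_rfl)]
    constructor
    · rintro rfl
      refine ⟨fun _ => 0, by simp, ?_⟩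
      funext j
      rw [if_neg (by omega)]
    · rintro ⟨y, -, rfl⟩
      funext j
      rw [if_neg (by omega)]
  | succ k ih =>
    obtain ⟨P, hP⟩ := ih (by omega)
    -- The value number `k` goes to register `b + k`, with auxiliary registers from `b + k + 1` on,
    -- so the values already written stay intact.
    obtain ⟨Q, hQ⟩ := hg ⟨k, hk⟩ a (b + k) (b + k + 1) (fun i => by have := ha i; omega)
      (fun i => by have := ha i; omega) (by omega)
    refine ⟨P.seq Q, fun s hs s' => ?_⟩
    simp only [Run]
    have key : ∀ y : ℕ → ℕ,
        (fun i => if b ≤ a i ∧ a i < b + k then y (a i - b) else s (a i)) = fun i => s (a i) := by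
      intro y
      funext i
      rw [if_neg (by have := ha i; omega)]
    constructor
    · rintro ⟨t, h1, h2⟩
      obtain ⟨y, hy, rfl⟩ := (hP s hs t).1 h1
      rw [hQ _ (by simp [hs]) (by intro j hj; rw [if_neg (by omega)]; exact hs j (by omega)),
        key] at h2
      obtain ⟨z, hz, rfl⟩ := h2
      refine ⟨update y k z, ?_, ?_⟩
      · intro i hi
        by_cases hik : (i : ℕ) = k
        · obtain rfl : i = ⟨k, hk⟩ := Fin.ext hik
          simpa using hz
        · rw [update_of_ne hik]
          exact hy i (by omega)
      · funext j
        simp only [update_apply]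
        split_ifs <;> first | rfl | omega
    · rintro ⟨y, hy, rfl⟩
      refine ⟨_, (hP s hs _).2 ⟨y, fun i hi => hy i (by omega), rfl⟩, ?_⟩
      rw [hQ _ (by simp [hs]) (by intro j hj; rw [if_neg (by omega)]; exact hs j (by omega)), key]
      refine ⟨y k, hy ⟨k, hk⟩ (by simp), ?_⟩
      funext j
      simp only [update_apply]
      split_ifs with h1 h2 h3 h4 <;> first | rfl | omega | (congr 1; omega)

/-- The assumption on register `b + k` lets the zero test act as a no-op when `k = 0`. In the
inductive step that register has just been cleared. -/
theorem exists_prog_clear (b k : ℕ) :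
    ∃ P : CounterProg ℕ, ∀ s : ℕ → ℕ, s (b + k) = 0 →
      P.RunsTo s fun j => if b ≤ j ∧ j < b + k then 0 else s j := by
  induction k with
  | zero =>
    refine ⟨act (.zero b), fun s hs => ?_⟩
    convert runsTo_zero (i := b) hs using 1
    funext j
    rw [if_neg (by omega)]
  | succ k ih =>
    obtain ⟨P, hP⟩ := ih
    refine ⟨(clear (b + k)).seq P, fun s hs => ?_⟩
    convert (runsTo_clear s (b + k)).seq (hP _ (by simp)) using 1
    funext j
    simp only [update_apply]
    split_ifs <;> first | rfl | omega

/-- The inner values are stored in the registers `b, …, b + m - 1`, the outer function reads them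
there, and then they are cleared, so that only `o` changes. The hypothesis `hh` describes
composition elementwise: all inner values must exist, as they do for partial recursive functions. -/
theorem Implements.comp {n m : ℕ} {f : List.Vector ℕ m →. ℕ} {g : Fin m → List.Vector ℕ n →. ℕ}
    {h : List.Vector ℕ n →. ℕ} (hf : Implements f) (hg : ∀ i, Implements (g i))
    (hh : ∀ v z, z ∈ h v ↔ ∃ y : Fin m → ℕ, (∀ i, y i ∈ g i v) ∧ z ∈ f (List.Vector.ofFn y)) :
    Implements h := by
  intro a o b ha hao hob
  obtain ⟨P, hP⟩ := exists_prog_write hg a b ha m le_rfl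
  obtain ⟨Q, hQ⟩ := hf (fun i => b + i) o (b + m) (fun i => by omega) (fun i => by omega)
    (by omega)
  obtain ⟨C, hC⟩ := exists_prog_clear b m
  refine ⟨P.seq (Q.seq C), fun s hs0 hs s' => ?_⟩
  have key : ∀ y : ℕ → ℕ, (fun i : Fin m => if b ≤ b + (i : ℕ) ∧ b + (i : ℕ) < b + m then
      y (b + i - b) else s (b + i)) = fun i : Fin m => y i := by
    intro y
    funext i
    rw [if_pos (by omega)]
    simp
  have key' : ∀ (y : ℕ → ℕ) (z : ℕ), (fun j => if b ≤ j ∧ j < b + m then 0 else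
      update (fun j => if b ≤ j ∧ j < b + m then y (j - b) else s j) o z j) = update s o z := by
    intro y z
    funext j
    simp only [update_apply]
    split_ifs <;> first | rfl | omega | (rw [hs j (by omega)])
  have hQ' : ∀ (y : ℕ → ℕ) s', Q.Run (fun j => if b ≤ j ∧ j < b + m then y (j - b) else s j) s' ↔
      ∃ z ∈ f (List.Vector.ofFn fun i : Fin m => y i), s' =
        update (fun j => if b ≤ j ∧ j < b + m then y (j - b) else s j) o z := by
    intro y s'
    rw [hQ _ (by rw [if_neg (by omega)]; exact hs0)
      (by intro j hj; rw [if_neg (by omega)]; exact hs j (by omega)), key]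
  have hC' : ∀ (y : ℕ → ℕ) (z : ℕ) s', C.Run
      (update (fun j => if b ≤ j ∧ j < b + m then y (j - b) else s j) o z) s' ↔
        s' = update s o z := by
    intro y z s'
    rw [hC _ (by rw [update_of_ne (by omega), if_neg (by omega)]; exact hs _ (by omega)), key']
  simp only [Run]
  constructor
  · rintro ⟨t, h1, u, h2, h3⟩
    obtain ⟨y, hy, rfl⟩ := (hP s hs t).1 h1
    obtain ⟨z, hz, rfl⟩ := (hQ' y u).1 h2
    rw [hC'] at h3
    exact ⟨z, (hh _ _).2 ⟨fun i => y i, fun i => hy i i.2, hz⟩, h3⟩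
  · rintro ⟨z, hz, rfl⟩
    obtain ⟨y, hy, hz⟩ := (hh _ _).1 hz
    -- `exists_prog_write` takes its values indexed by all of `ℕ`; the entries from `m` on are
    -- irrelevant.
    let y' : ℕ → ℕ := fun i => if h : i < m then y ⟨i, h⟩ else 0
    have hy' : (fun i : Fin m => y' i) = y := by funext i; simp [y']
    refine ⟨_, (hP s hs _).2 ⟨y', fun i _ => ?_, rfl⟩, _,
      (hQ' y' _).2 ⟨z, by rwa [hy'], rfl⟩, (hC' _ _ _).2 rfl⟩
    rw [congrFun hy' i]
    exact hy i

theorem implements_iff_of_total {n : ℕ} (f : List.Vector ℕ n → ℕ) :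
    Implements (f : List.Vector ℕ n →. ℕ) ↔
    ∀ (a : Fin n → ℕ) (o b : ℕ), (∀ i, a i < b) → (∀ i, a i ≠ o) → o < b →
    ∃ P : CounterProg ℕ, ∀ s : ℕ → ℕ, s o = 0 → (∀ j, b ≤ j → s j = 0) →
      P.RunsTo s (update s o (f (List.Vector.ofFn fun i => s (a i)))) := by
  simp [Implements, RunsTo]

theorem implements_zero : Implements ((fun _ => 0 : List.Vector ℕ 0 → ℕ) : List.Vector ℕ 0 →. ℕ) :=
  (implements_iff_of_total _).2 fun _ o _ _ _ _ => ⟨clear o, fun s _ _ => runsTo_clear s o⟩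

theorem implements_get {n : ℕ} (i : Fin n) :
    Implements ((fun v => v.get i : List.Vector ℕ n → ℕ) : List.Vector ℕ n →. ℕ) := by
  refine (implements_iff_of_total _).2 fun a o b ha hao hob =>
    ⟨copy (a i) o b, fun s hs0 hs => ?_⟩
  rw [List.Vector.get_ofFn]
  exact runsTo_copy (hao i) (ha i).ne hob.ne hs0 (hs b le_rfl)

theorem implements_succ :
    Implements ((fun v => v.head.succ : List.Vector ℕ 1 → ℕ) : List.Vector ℕ 1 →. ℕ) := by
  refine (implements_iff_of_total _).2 fun a o b ha hao hob =>
    ⟨(copy (a 0) o b).seq (act (.inc o)), fun s hs0 hs => ?_⟩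
  convert (runsTo_copy (hao 0) (ha 0).ne hob.ne hs0 (hs b le_rfl)).seq (runsTo_inc _ o) using 1
  simp

/-- Register `b` counts the remaining iterations down, `b + 1` holds the recursion index, `o` the
current value, `b + 2` the next value, and `b + 3` is scratch space for copying. The next value
cannot be computed directly into `o`, because `o` is an input of that computation. -/
theorem Implements.prec {n : ℕ} {f : List.Vector ℕ n → ℕ} {g : List.Vector ℕ (n + 2) → ℕ}
    (hf : Implements (f : List.Vector ℕ n →. ℕ))
    (hg : Implements (g : List.Vector ℕ (n + 2) →. ℕ)) :
    Implements ((fun v => v.head.rec (f v.tail) fun y IH => g (y ::ᵥ IH ::ᵥ v.tail) :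
      List.Vector ℕ (n + 1) → ℕ) : List.Vector ℕ (n + 1) →. ℕ) := by
  rw [implements_iff_of_total] at hf hg ⊢
  intro a o b ha hao hob
  obtain ⟨F, hF⟩ := hf (fun i => a i.succ) o (b + 3) (fun i => by have := ha i.succ; omega)
    (fun i => hao _) (by omega)
  obtain ⟨G, hG⟩ := hg (Fin.cons (b + 1) (Fin.cons o fun i => a i.succ)) (b + 2) (b + 3)
    (by
      refine Fin.cases ?_ (Fin.cases ?_ fun i => ?_)
      · simp
      · simp; omega
      · have := ha i.succ
        simp; omega)
    (by
      refine Fin.cases ?_ (Fin.cases ?_ fun i => ?_)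
      · simp
      · simp; omega
      · have := ha i.succ
        simp; omega) (by omega)
  refine ⟨(copy (a 0) b (b + 3)).seq (F.seq ((loop b ((act (.dec b)).seq (G.seq ((clear o).seq
    ((copy (b + 2) o (b + 3)).seq ((clear (b + 2)).seq (act (.inc (b + 1))))))))).seq
      (clear (b + 1)))), fun s hs0 hs => ?_⟩
  set w : List.Vector ℕ n := List.Vector.ofFn fun i => s (a i.succ) with hw
  let val : ℕ → ℕ := fun k => k.rec (f w) fun y IH => g (y ::ᵥ IH ::ᵥ w)
  -- The state after `k` iterations.
  let σ : ℕ → ℕ → ℕ := fun k =>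
    update (update (update s b (s (a 0) - k)) (b + 1) k) o (val k)
  have ha0 := ha 0
  have h1 : (copy (a 0) b (b + 3)).RunsTo s (update s b (s (a 0))) :=
    runsTo_copy (by omega) (by omega) (by omega) (hs b le_rfl) (hs _ (by omega))
  have h2 : F.RunsTo (update s b (s (a 0))) (σ 0) := by
    convert hF (update s b (s (a 0))) (by rw [update_of_ne (by omega)]; exact hs0)
      (fun j hj => by rw [update_of_ne (by omega)]; exact hs j (by omega)) using 1
    have : (fun i : Fin n => update s b (s (a 0)) (a i.succ)) = fun i => s (a i.succ) := by
      funext i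
      rw [update_of_ne (by have := ha i.succ; omega)]
    rw [this]
    funext j
    simp only [σ, val, update_apply, ← hw]
    split_ifs <;> first | rfl | omega | simp_all
  have h3 := runsTo_loop (P := (act (.dec b)).seq (G.seq ((clear o).seq
    ((copy (b + 2) o (b + 3)).seq ((clear (b + 2)).seq (act (.inc (b + 1)))))))) (i := b)
    σ (s (a 0))
    (by
      intro k hk
      simp only [σ]
      rw [update_of_ne (by omega), update_of_ne (by omega), update_self]
      omega)
    (by
      simp only [σ]
      rw [update_of_ne (by omega), update_of_ne (by omega), update_self]
      omega)
    (by
      intro k hk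
      have e1 : σ k b = s (a 0) - k := by
        simp only [σ]
        rw [update_of_ne (by omega), update_of_ne (by omega), update_self]
      let τ : ℕ → ℕ := update (σ k) b (s (a 0) - (k + 1))
      have p1 : (act (.dec b)).RunsTo (σ k) τ := by
        convert runsTo_dec (s := σ k) (i := b) (by omega) using 1
        rw [e1]
        simp [τ, Nat.sub_sub]
      have hz : ∀ j, b + 2 ≤ j → τ j = 0 := by
        intro j hj
        simp only [τ, σ, update_apply]
        rw [if_neg (by omega), if_neg (by omega), if_neg (by omega), if_neg (by omega)]
        exact hs j (by omega)
      have p2 : G.RunsTo τ (update τ (b + 2) (val (k + 1))) := by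
        convert hG τ (hz _ le_rfl) (fun j hj => hz j (by omega)) using 1
        congr 1
        have q1 : τ (b + 1) = k := by
          simp only [τ, σ, update_apply]
          rw [if_neg (by omega), if_neg (by omega), if_pos trivial]
        have q2 : τ o = val k := by
          simp only [τ, σ, update_apply]
          rw [if_neg (by omega), if_pos trivial]
        have q3 : ∀ i : Fin n, τ (a i.succ) = s (a i.succ) := by
          intro i
          have := ha i.succ
          simp only [τ, σ, update_apply]
          rw [if_neg (by omega), if_neg (hao _), if_neg (by omega), if_neg (by omega)]
        simp only [val, hw]
        congr 1
        simp [List.Vector.ofFn, q1, q2, q3, val, hw]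
      have p3 := runsTo_clear (update τ (b + 2) (val (k + 1))) o
      have p4 : (copy (b + 2) o (b + 3)).RunsTo
          (update (update τ (b + 2) (val (k + 1))) o 0) _ :=
        runsTo_copy (by omega) (by omega) (by omega) (by simp)
          (by rw [update_of_ne (by omega), update_of_ne (by omega)]; exact hz _ (by omega))
      convert p1.seq (p2.seq (p3.seq (p4.seq ((runsTo_clear _ (b + 2)).seq
        (runsTo_inc _ (b + 1)))))) using 1
      funext j
      have hz2 : s (b + 2) = 0 := hs _ (by omega)
      simp only [τ, σ, update_apply]
      by_cases c1 : j = o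
      · subst c1
        simp
        rw [if_neg (by omega), if_neg (by omega), if_neg (by omega)]
      by_cases c2 : j = b + 2
      · subst c2
        simp [c1, hz2]
      by_cases c3 : j = b + 1
      · subst c3
        simp [c1]
      by_cases c4 : j = b
      · subst c4
        simp [c1]
      simp [c1, c2, c3, c4])
    (fun t => not_run_seq_dec _ (by
      simp only [σ]
      rw [update_of_ne (by omega), update_of_ne (by omega), update_self]
      omega))
  convert h1.seq (h2.seq (h3.seq (runsTo_clear _ (b + 1)))) using 1
  funext j
  have hz0 : s b = 0 := hs _ (by omega)
  have hz1 : s (b + 1) = 0 := hs _ (by omega)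
  have hhead : (List.Vector.ofFn fun i => s (a i)).head = s (a 0) := by simp [List.Vector.ofFn]
  have htail : (List.Vector.ofFn fun i => s (a i)).tail = w := by simp [List.Vector.ofFn, hw]
  rw [hhead, htail]
  simp only [σ, update_apply]
  by_cases c1 : j = o
  · subst c1
    rw [if_pos rfl, if_neg (by omega), if_pos rfl]
  by_cases c3 : j = b + 1
  · subst c3
    simp [c1, hz1]
  by_cases c4 : j = b
  · subst c4
    simp [c1, hz0]
  simp [c1, c3, c4]

theorem implements_of_primrec' {n : ℕ} {f : List.Vector ℕ n → ℕ} (hf : Nat.Primrec' f) :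
    Implements (f : List.Vector ℕ n →. ℕ) := by
  induction hf with
  | zero => exact implements_zero
  | succ => exact implements_succ
  | get i => exact implements_get i
  | comp g _ _ ihf ihg =>
    refine ihf.comp ihg fun v z => ?_
    simp only [PFun.coe_val, Part.mem_some_iff]
    constructor
    · rintro rfl
      exact ⟨_, fun _ => rfl, rfl⟩
    · rintro ⟨y, hy, rfl⟩
      rw [funext hy]
  | prec _ _ ihf ihg => exact ihf.prec ihg

/-- Register `o` holds the current candidate and `b` the value of `f` there. The loop ends exactly
when `b` is zero. The decrement preceding the clearing of `b` looks redundant, but it blocks a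
further iteration after a zero has been found. -/
theorem Implements.rfind {n : ℕ} {f : List.Vector ℕ (n + 1) → ℕ}
    (hf : Implements (f : List.Vector ℕ (n + 1) →. ℕ)) :
    Implements fun v : List.Vector ℕ n =>
      Nat.rfind fun k => Part.some (decide (f (k ::ᵥ v) = 0)) := by
  rw [implements_iff_of_total] at hf
  intro a o b ha hao hob
  obtain ⟨F, hF⟩ := hf (Fin.cons o a) b (b + 1)
    (by
      refine Fin.cases ?_ fun i => ?_
      · simp; omega
      · have := ha i
        simp; omega)
    (by
      refine Fin.cases ?_ fun i => ?_
      · simp; omega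
      · have := ha i
        simp; omega) (by omega)
  refine ⟨F.seq (loop b ((act (.dec b)).seq ((clear b).seq ((act (.inc o)).seq F)))),
    fun s hs0 hs s' => ?_⟩
  set w : List.Vector ℕ n := List.Vector.ofFn fun i => s (a i) with hw
  let σ : ℕ → ℕ → ℕ := fun k => update (update s o k) b (f (k ::ᵥ w))
  have hzb : s b = 0 := hs b le_rfl
  have hσb : ∀ k, σ k b = f (k ::ᵥ w) := fun k => by simp [σ]
  have hF' : ∀ k, F.RunsTo (update s o k) (σ k) := by
    intro k
    convert hF (update s o k) (by rw [update_of_ne (by omega)]; exact hzb)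
      (fun j hj => by rw [update_of_ne (by omega)]; exact hs j (by omega)) using 1
    simp only [σ]
    congr 2
    have : ∀ i, update s o k (a i) = s (a i) := fun i => by rw [update_of_ne (hao i)]
    simp [List.Vector.ofFn, this, hw]
  have h0 : F.RunsTo s (σ 0) := by
    convert hF' 0 using 1
    rw [← hs0, update_eq_self]
  have hstep : ∀ k, f (k ::ᵥ w) ≠ 0 →
      ((act (.dec b)).seq ((clear b).seq ((act (.inc o)).seq F))).RunsTo (σ k) (σ (k + 1)) := by
    intro k hk
    refine (runsTo_dec (by rwa [hσb])).seq ((runsTo_clear _ b).seq ((runsTo_inc _ o).seq ?_))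
    convert hF' (k + 1) using 1
    funext j
    simp only [σ, update_apply]
    by_cases c1 : j = o
    · subst c1
      simp [hob.ne]
    by_cases c2 : j = b
    · subst c2
      simp [c1, hzb]
    simp [c1, c2]
  have hrun : (F.seq (loop b ((act (.dec b)).seq ((clear b).seq ((act (.inc o)).seq F))))).Run s s'
      ↔ (loop b ((act (.dec b)).seq ((clear b).seq ((act (.inc o)).seq F)))).Run (σ 0) s' := by
    simp [Run, h0 _]
  rw [hrun]
  by_cases hex : ∃ N, f (N ::ᵥ w) = 0
  · classical
    have hN := Nat.find_spec hex
    have hlt : ∀ k < Nat.find hex, f (k ::ᵥ w) ≠ 0 := fun k hk => Nat.find_min hex hk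
    rw [runsTo_loop σ (Nat.find hex) (fun k hk => by rw [hσb]; exact hlt k hk)
      (by rw [hσb]; exact hN) (fun k hk => hstep k (hlt k hk))
      (fun t => not_run_seq_dec _ (by rw [hσb]; exact hN))]
    have hσN : σ (Nat.find hex) = update s o (Nat.find hex) := by
      funext j
      simp only [σ, hN, update_apply]
      by_cases c2 : j = b
      · subst c2
        simp [hob.ne', hzb]
      simp [c2]
    have hmem : ∀ y, y ∈ (Nat.rfind fun k => Part.some (decide (f (k ::ᵥ w) = 0))) ↔
        y = Nat.find hex := by
      intro y
      refine Nat.mem_rfind.trans ?_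
      rw [@eq_comm _ y, Nat.find_eq_iff]
      simp
    rw [hσN]
    simp only [hmem, exists_eq_left]
  -- Without a zero of `f` the loop can never be left, which matches the undefined search.
  · push Not at hex
    refine iff_of_false (not_run_loop σ (fun k => by rw [hσb]; exact hex k)
      (fun k => hstep k (hex k)) s') ?_
    rintro ⟨y, hy, -⟩
    simpa [hex] using (Nat.mem_rfind.1 hy).1

theorem mem_mOfFn {n : ℕ} (g : Fin n → Part ℕ) (v : List.Vector ℕ n) :
    v ∈ List.Vector.mOfFn g ↔ ∀ i, v.get i ∈ g i := by
  induction n with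
  | zero => simp [List.Vector.mOfFn, List.Vector.eq_nil v]
  | succ n ih =>
    simp only [List.Vector.mOfFn, Part.pure_eq_some, Part.bind_eq_bind, Part.mem_bind_iff,
      Part.mem_some_iff, ih, Fin.forall_fin_succ]
    constructor
    · rintro ⟨x, hx, u, hu, rfl⟩
      simpa using ⟨hx, hu⟩
    · rintro ⟨h0, h⟩
      refine ⟨_, h0, v.tail, by simpa using h, ?_⟩
      simp

theorem implements_of_partrec' {n : ℕ} {f : List.Vector ℕ n →. ℕ} (hf : Nat.Partrec' f) :
    Implements f := by
  induction hf with
  | prim hf => exact implements_of_primrec' hf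
  | comp g _ _ ihf ihg =>
    refine ihf.comp ihg fun v z => ?_
    refine Part.mem_bind_iff.trans ?_
    simp only [mem_mOfFn]
    constructor
    · rintro ⟨u, hu, hz⟩
      refine ⟨u.get, hu, ?_⟩
      rwa [List.Vector.ofFn_get]
    · rintro ⟨y, hy, hz⟩
      exact ⟨_, by simpa using hy, hz⟩
  | rfind _ ih => exact Implements.rfind ih

/-- The domain of a partial recursive function is the set of inputs from which some counter
program can reach the state in which all registers are zero. -/
theorem exists_prog_of_partrec {f : ℕ →. ℕ} (hf : Partrec f) :
    ∃ P : CounterProg ℕ, ∀ n, (f n).Dom ↔ P.Run (update 0 0 n) 0 := by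
  obtain ⟨P, hP⟩ := implements_of_partrec' (Nat.Partrec'.part_iff₁.2 hf) (fun _ => 0) 1 2
    (by simp) (by simp) (by simp)
  -- Input and output are erased; all other registers are zero already.
  refine ⟨P.seq ((clear 0).seq (clear 1)), fun n => ?_⟩
  have hP' := hP (update 0 0 n) (by simp) (fun j hj => by rw [update_of_ne (by omega)]; rfl)
  have hC : ∀ t : ℕ → ℕ, ((clear 0).seq (clear 1)).RunsTo t (update (update t 0 0) 1 0) :=
    fun t => (runsTo_clear t 0).seq (runsTo_clear _ 1)
  have hhead : (List.Vector.ofFn fun _ : Fin 1 => update (0 : ℕ → ℕ) 0 n 0).head = n := by simp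
  beta_reduce at hP'
  rw [hhead] at hP'
  rw [Part.dom_iff_mem]
  constructor
  · rintro ⟨y, hy⟩
    refine ⟨_, (hP' _).2 ⟨y, hy, rfl⟩, (hC _ _).2 ?_⟩
    funext j
    simp only [update_apply, Pi.zero_apply]
    split_ifs <;> rfl
  · rintro ⟨t, h, -⟩
    obtain ⟨y, hy, -⟩ := (hP' _).1 h
    exact ⟨y, hy⟩

end CounterProg

/-! ### Traces of counter programs -/

namespace CounterAct

variable {ι κ : Type}

/-- The register on which an action operates. -/
def reg : CounterAct ι → ι
  | inc i => i
  | dec i => i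
  | zero i => i

/-- Renaming of registers. -/
def map (f : ι → κ) : CounterAct ι → CounterAct κ
  | inc i => inc (f i)
  | dec i => dec (f i)
  | zero i => zero (f i)

variable [DecidableEq ι] [DecidableEq κ]

theorem upd_of_reg_ne {i : ι} {a : CounterAct ι} (h : a.reg ≠ i) (c d : ℕ) :
    a.Upd i c d ↔ d = c := by
  cases a <;> simp_all [Upd, reg, eq_comm]

theorem upd_map {f : ι → κ} {i : ι} {j : κ} {a : CounterAct ι} (h : f a.reg = j ↔ a.reg = i)
    (c d : ℕ) : (a.map f).Upd j c d ↔ a.Upd i c d := by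
  cases a <;> simp_all [Upd, reg, map]

/-- The register `i` can change from `c` to `d` by the given sequence of actions. -/
def Tracks (i : ι) : List (CounterAct ι) → ℕ → ℕ → Prop
  | [], c, d => d = c
  | a :: w, c, d => ∃ e, a.Upd i c e ∧ Tracks i w e d

theorem tracks_append {i : ι} {w w' : List (CounterAct ι)} {c d : ℕ} :
    Tracks i (w ++ w') c d ↔ ∃ e, Tracks i w c e ∧ Tracks i w' e d := by
  induction w generalizing c with
  | nil => simp [Tracks]
  | cons a w ih =>
    simp only [List.cons_append, Tracks, ih]
    constructor
    · rintro ⟨e, h, e', h', h''⟩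
      exact ⟨e', ⟨e, h, h'⟩, h''⟩
    · rintro ⟨e', ⟨e, h, h'⟩, h''⟩
      exact ⟨e, h, e', h', h''⟩

theorem tracks_of_reg_ne {i : ι} {w : List (CounterAct ι)} (h : ∀ a ∈ w, a.reg ≠ i) (c d : ℕ) :
    Tracks i w c d ↔ d = c := by
  induction w with
  | nil => rfl
  | cons a w ih =>
    simp only [List.forall_mem_cons] at h
    simp [Tracks, ih h.2, upd_of_reg_ne h.1]

theorem tracks_map {f : ι → κ} {i : ι} {j : κ} {w : List (CounterAct ι)}
    (h : ∀ a ∈ w, (f a.reg = j ↔ a.reg = i)) (c d : ℕ) :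
    Tracks j (w.map (map f)) c d ↔ Tracks i w c d := by
  induction w generalizing c with
  | nil => rfl
  | cons a w ih =>
    simp only [List.forall_mem_cons] at h
    simp [Tracks, ih h.2, upd_map h.1]

theorem tracks_replicate_inc (i j : ι) (n c d : ℕ) :
    Tracks i (List.replicate n (inc j)) c d ↔ d = if j = i then c + n else c := by
  induction n generalizing c with
  | zero => simp [Tracks]
  | succ n ih =>
    simp only [List.replicate_succ, Tracks, ih, Upd, exists_eq_left]
    split_ifs <;> simp [add_assoc, add_comm 1 n]

end CounterAct

namespace CounterProg

open CounterAct

variable {ι : Type}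

/-- The sequences of actions that a program may perform. -/
inductive Trace : CounterProg ι → List (CounterAct ι) → Prop
  | act (a) : Trace (act a) [a]
  | seq {P Q w w'} : Trace P w → Trace Q w' → Trace (seq P Q) (w ++ w')
  | loop_done (i P) : Trace (loop i P) [.zero i]
  | loop_step {i P w w'} : Trace P w → Trace (loop i P) w' → Trace (loop i P) (w ++ w')

theorem trace_act_iff {a : CounterAct ι} {w : List (CounterAct ι)} :
    (act a).Trace w ↔ w = [a] :=
  ⟨fun h => by cases h; rfl, fun h => h ▸ .act a⟩

theorem trace_seq_iff {P Q : CounterProg ι} {w : List (CounterAct ι)} :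
    (P.seq Q).Trace w ↔ ∃ u v, P.Trace u ∧ Q.Trace v ∧ w = u ++ v :=
  ⟨fun h => by cases h with | seq h h' => exact ⟨_, _, h, h', rfl⟩,
    by rintro ⟨u, v, h, h', rfl⟩; exact .seq h h'⟩

theorem Trace.loop_induction {i : ι} {P : CounterProg ι} (p : List (CounterAct ι) → Prop)
    (done : p [.zero i]) (step : ∀ w w', P.Trace w → p w' → p (w ++ w'))
    {w : List (CounterAct ι)} (h : (loop i P).Trace w) : p w := by
  generalize hQ : loop i P = Q at h
  induction h with
  | act => cases hQ
  | seq => cases hQ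
  | loop_done => cases hQ; exact done
  | loop_step h _ _ ih => cases hQ; exact step _ _ h (ih rfl)

/-- An action relates two states by a conjunction over the registers. Once the trace is fixed, the
registers can be followed separately, and the intermediate states are assembled from choices made
register by register. -/
theorem run_iff_exists_trace [DecidableEq ι] {P : CounterProg ι} {s s' : ι → ℕ} :
    P.Run s s' ↔ ∃ w, P.Trace w ∧ ∀ i, Tracks i w (s i) (s' i) := by
  induction P generalizing s s' with
  | act a => simp [trace_act_iff, Run, Tracks]
  | seq P Q ihP ihQ =>
    simp only [Run, ihP, ihQ]
    constructor
    · rintro ⟨t, ⟨u, hu, hu'⟩, v, hv, hv'⟩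
      exact ⟨_, .seq hu hv, fun i => tracks_append.2 ⟨_, hu' i, hv' i⟩⟩
    · rintro ⟨w, hw, h⟩
      obtain ⟨u, v, hu, hv, rfl⟩ := trace_seq_iff.1 hw
      choose t ht ht' using fun i => tracks_append.1 (h i)
      exact ⟨t, ⟨u, hu, ht⟩, v, hv, ht'⟩
  | loop i P ih =>
    simp only [Run]
    constructor
    · rintro ⟨h, h0⟩
      induction h using Relation.ReflTransGen.head_induction_on with
      | refl =>
        refine ⟨_, .loop_done i P, fun j => ?_⟩
        simp only [Tracks, Upd]
        exact ⟨_, ⟨rfl, fun hj => hj ▸ h0⟩, rfl⟩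
      | head h' _ ih' =>
        obtain ⟨u, hu, hu'⟩ := ih.1 h'
        obtain ⟨v, hv, hv'⟩ := ih'
        exact ⟨_, .loop_step hu hv, fun i => tracks_append.2 ⟨_, hu' i, hv' i⟩⟩
    · rintro ⟨w, hw, h⟩
      revert s
      refine hw.loop_induction (fun w => ∀ {s : ι → ℕ}, (∀ i, Tracks i w (s i) (s' i)) →
        Relation.ReflTransGen P.Run s s' ∧ s' i = 0) ?_ ?_
      · intro s h
        simp only [Tracks, Upd] at h
        obtain rfl : s' = s := by
          funext j
          obtain ⟨e, ⟨he, -⟩, he'⟩ := h j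
          exact he'.trans he
        obtain ⟨e, ⟨-, he⟩, -⟩ := h i
        exact ⟨.refl, he rfl⟩
      · intro u v hu hv s h
        choose t ht ht' using fun i => tracks_append.1 (h i)
        obtain ⟨h1, h2⟩ := hv ht'
        exact ⟨.head (ih.2 ⟨u, hu, ht⟩) h1, h2⟩

theorem exists_reg_bound (P : CounterProg ℕ) :
    ∃ R, ∀ w, P.Trace w → ∀ a ∈ w, a.reg < R := by
  induction P with
  | act a =>
    refine ⟨a.reg + 1, fun w hw => ?_⟩
    rw [trace_act_iff.1 hw]
    simp
  | seq P Q ihP ihQ =>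
    obtain ⟨R, hR⟩ := ihP
    obtain ⟨R', hR'⟩ := ihQ
    refine ⟨max R R', fun w hw a ha => ?_⟩
    obtain ⟨u, v, hu, hv, rfl⟩ := trace_seq_iff.1 hw
    rcases List.mem_append.1 ha with ha | ha
    · exact lt_max_of_lt_left (hR u hu a ha)
    · exact lt_max_of_lt_right (hR' v hv a ha)
  | loop i P ih =>
    obtain ⟨R, hR⟩ := ih
    refine ⟨max R (i + 1), fun w hw => ?_⟩
    refine hw.loop_induction (fun w => ∀ a ∈ w, a.reg < max R (i + 1)) ?_ ?_
    · simp [reg]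
    · intro u v hu hv a ha
      rcases List.mem_append.1 ha with ha | ha
      · exact lt_max_of_lt_left (hR u hu a ha)
      · exact hv a ha

/-- Reachability of the zero state, in terms of traces over finitely many registers. -/
theorem run_zero_iff {P : CounterProg ℕ} {R : ℕ} (hR : ∀ w, P.Trace w → ∀ a ∈ w, a.reg < R)
    (n : ℕ) :
    P.Run (update 0 0 n) 0 ↔ ∃ w, P.Trace w ∧ ∀ i : Fin (R + 1),
      Tracks i (List.replicate n (inc 0) ++ w.map (map (Fin.ofNat (R + 1)))) 0 0 := by
  rw [run_iff_exists_trace]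
  refine exists_congr fun w => and_congr_right fun hw => ?_
  have key : ∀ i : Fin (R + 1),
      Tracks i (List.replicate n (inc 0) ++ w.map (map (Fin.ofNat (R + 1)))) 0 0 ↔
        Tracks (i : ℕ) w (update (0 : ℕ → ℕ) 0 n (i : ℕ)) 0 := by
    intro i
    simp only [tracks_append, tracks_replicate_inc, exists_eq_left]
    rw [tracks_map (i := (i : ℕ))]
    · have : (if (0 : Fin (R + 1)) = i then 0 + n else 0) = update (0 : ℕ → ℕ) 0 n (i : ℕ) := by
        by_cases h : i = 0
        · subst h
          simp
        · have h' : (i : ℕ) ≠ 0 := fun h' => h (Fin.ext h')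
          simp [Ne.symm h, h']
      rw [this]
    · intro a ha
      have := hR w hw a ha
      -- Reduction modulo `R + 1` does not identify registers, because all those used are below `R`.
      rw [Fin.ext_iff, Fin.val_ofNat, Nat.mod_eq_of_lt (by omega)]
  simp only [key]
  constructor
  · exact fun h i => h i
  · intro h i
    by_cases hi : i < R + 1
    · exact h ⟨i, hi⟩
    -- Registers outside the range are never used, and they start at zero.
    · rw [tracks_of_reg_ne fun a ha => by have := hR w hw a ha; omega]
      rw [update_of_ne (by omega)]

end CounterProg

/-! ### Leftmost derivations -/

/-- `LeftGen R u w` means that the word `w` has a leftmost derivation from `u` with the rules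
`R`. -/
inductive LeftGen {T N : Type*} (R : N → List (Symbol T N) → Prop) :
    List (Symbol T N) → List T → Prop
  | nil : LeftGen R [] []
  | terminal (a) {u w} : LeftGen R u w → LeftGen R (.terminal a :: u) (a :: w)
  | nonterminal {v γ u w} : R v γ → LeftGen R (γ ++ u) w → LeftGen R (.nonterminal v :: u) w

namespace LeftGen

variable {T N : Type*} {R : N → List (Symbol T N) → Prop}

theorem append {u u' : List (Symbol T N)} {w w' : List T} (h : LeftGen R u w)
    (h' : LeftGen R u' w') : LeftGen R (u ++ u') (w ++ w') := by
  induction h with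
  | nil => exact h'
  | terminal a _ ih => exact .terminal a ih
  | nonterminal hr _ ih => exact .nonterminal hr (by simpa using ih)

theorem of_rule {v : N} {γ : List (Symbol T N)} {w : List T} (hr : R v γ) (h : LeftGen R γ w) :
    LeftGen R [.nonterminal v] w := .nonterminal hr (by simpa using h)

theorem map_terminal (w : List T) : LeftGen R (w.map .terminal) w := by
  induction w with
  | nil => exact .nil
  | cons a w ih => exact .terminal a ih

/-- A rewriting step in the middle is postponed until its variable is leftmost; the leftmost
derivation of the rewritten sequence shows when this happens. -/
theorem of_middle {v : N} {γ : List (Symbol T N)} (hr : R v γ) {q u : List (Symbol T N)}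
    {w : List T} (h : LeftGen R u w) :
    ∀ p, u = p ++ γ ++ q → LeftGen R (p ++ .nonterminal v :: q) w := by
  induction h with
  | nil =>
    intro p hp
    obtain ⟨rfl, rfl, rfl⟩ : p = [] ∧ γ = [] ∧ q = [] := by simpa using hp.symm
    exact .nonterminal hr .nil
  | terminal a h ih =>
    rintro (_ | ⟨x, p⟩) hp
    · refine .nonterminal hr ?_
      rw [← List.nil_append γ, ← hp]
      exact .terminal a h
    · simp only [List.cons_append, List.cons.injEq] at hp
      obtain ⟨rfl, hp⟩ := hp
      exact .terminal a (ih p hp)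
  | @nonterminal _ δ _ _ hr' h ih =>
    rintro (_ | ⟨x, p⟩) hp
    · refine .nonterminal hr ?_
      rw [← List.nil_append γ, ← hp]
      exact .nonterminal hr' h
    · simp only [List.cons_append, List.cons.injEq] at hp
      obtain ⟨rfl, rfl⟩ := hp
      refine .nonterminal hr' ?_
      have := ih (δ ++ p) (by simp only [List.append_assoc])
      rwa [List.append_assoc] at this

end LeftGen

theorem ContextFreeGrammar.derives_iff_leftGen {T : Type*} (g : ContextFreeGrammar T)
    (u : List (Symbol T g.NT)) (w : List T) :
    g.Derives u (w.map Symbol.terminal) ↔ LeftGen (fun v γ => ⟨v, γ⟩ ∈ g.rules) u w := by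
  constructor
  · intro h
    induction h using Relation.ReflTransGen.head_induction_on with
    | refl => exact .map_terminal w
    | head h _ ih =>
      obtain ⟨r, hr, h⟩ := h
      obtain ⟨p, q, rfl, rfl⟩ := h.exists_parts
      simpa using LeftGen.of_middle (R := fun v γ => ⟨v, γ⟩ ∈ g.rules) (v := r.input) hr ih p rfl
  · intro h
    induction h with
    | nil => exact Derives.refl _
    | terminal a _ ih => exact ih.append_left [.terminal a]
    | @nonterminal v γ u w hr _ ih =>
      exact Produces.trans_derives ⟨_, hr, .head u⟩ ih

/-- Renaming of the letters and variables in a symbol. -/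
def Symbol.rename {T T' N N' : Type*} (f : T → T') (g : N → N') : Symbol T N → Symbol T' N'
  | .terminal a => .terminal (f a)
  | .nonterminal v => .nonterminal (g v)

theorem LeftGen.rename {T T' N N' : Type*} {R : N → List (Symbol T N) → Prop}
    {R' : N' → List (Symbol T' N') → Prop} (f : T → T') (g : N → N')
    (hR : ∀ v γ, R v γ → R' (g v) (γ.map (Symbol.rename f g))) {u : List (Symbol T N)} {w : List T}
    (h : LeftGen R u w) : LeftGen R' (u.map (Symbol.rename f g)) (w.map f) := by
  induction h with
  | nil => exact .nil
  | terminal a _ ih => exact .terminal (f a) ih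
  | nonterminal hr _ ih => exact .nonterminal (hR _ _ hr) (by simpa using ih)

/-- The words obtained from a sequence by substituting words from the language `I v` for each
variable `v`. -/
def SubstWords {T N : Type*} (I : N → List T → Prop) : List (Symbol T N) → List T → Prop
  | [], w => w = []
  | .terminal a :: u, w => ∃ w', w = a :: w' ∧ SubstWords I u w'
  | .nonterminal v :: u, w => ∃ w₁ w₂, w = w₁ ++ w₂ ∧ I v w₁ ∧ SubstWords I u w₂

theorem substWords_append {T N : Type*} {I : N → List T → Prop} {u u' : List (Symbol T N)}
    {w : List T} (h : SubstWords I (u ++ u') w) :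
    ∃ w₁ w₂, w = w₁ ++ w₂ ∧ SubstWords I u w₁ ∧ SubstWords I u' w₂ := by
  induction u generalizing w with
  | nil => exact ⟨[], w, rfl, rfl, h⟩
  | cons x u ih =>
    rcases x with a | v
    · obtain ⟨w', rfl, h⟩ := h
      obtain ⟨w₁, w₂, rfl, h₁, h₂⟩ := ih h
      exact ⟨a :: w₁, w₂, rfl, ⟨w₁, rfl, h₁⟩, h₂⟩
    · obtain ⟨w', w'', rfl, hv, h⟩ := h
      obtain ⟨w₁, w₂, rfl, h₁, h₂⟩ := ih h
      exact ⟨w' ++ w₁, w₂, by simp, ⟨w', w₁, rfl, hv, h₁⟩, h₂⟩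

/-- A family of languages that is closed under the rules contains all derivable words. -/
theorem LeftGen.substWords {T N : Type*} {R : N → List (Symbol T N) → Prop}
    {I : N → List T → Prop} (hI : ∀ v γ w, R v γ → SubstWords I γ w → I v w)
    {u : List (Symbol T N)} {w : List T} (h : LeftGen R u w) : SubstWords I u w := by
  induction h with
  | nil => rfl
  | terminal a _ ih => exact ⟨_, rfl, ih⟩
  | nonterminal hr _ ih =>
    obtain ⟨w₁, w₂, rfl, h₁, h₂⟩ := substWords_append ih
    exact ⟨w₁, w₂, rfl, hI _ _ _ hr h₁, h₂⟩

/-! ### A grammar for the traces of a counter program -/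

instance {ι : Type} [Finite ι] : Finite (CounterAct ι) :=
  Finite.of_surjective
    (fun x : ι ⊕ ι ⊕ ι => x.elim CounterAct.inc (Sum.elim CounterAct.dec CounterAct.zero)) fun a =>
      match a with
      | .inc i => ⟨.inl i, rfl⟩
      | .dec i => ⟨.inr (.inl i), rfl⟩
      | .zero i => ⟨.inr (.inr i), rfl⟩

namespace CounterProg

/-- The subprograms of a program. -/
def subs {ι : Type} : CounterProg ι → List (CounterProg ι)
  | act a => [act a]
  | seq P Q => seq P Q :: (P.subs ++ Q.subs)
  | loop i P => loop i P :: P.subs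

theorem self_mem_subs {ι : Type} (P : CounterProg ι) : P ∈ P.subs := by
  cases P <;> simp [subs]

theorem mem_subs_of_seq_mem {ι : Type} {P A B : CounterProg ι} (h : seq A B ∈ P.subs) :
    A ∈ P.subs ∧ B ∈ P.subs := by
  induction P with
  | act a => simp [subs] at h
  | seq P Q ihP ihQ =>
    simp only [subs, List.mem_cons, List.mem_append, seq.injEq] at h ⊢
    rcases h with ⟨rfl, rfl⟩ | h | h
    · simp [self_mem_subs]
    · simp [ihP h]
    · simp [ihQ h]
  | loop i P ih =>
    simp only [subs, List.mem_cons, reduceCtorEq, false_or] at h ⊢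
    simp [ih h]

theorem mem_subs_of_loop_mem {ι : Type} {P A : CounterProg ι} {i : ι} (h : loop i A ∈ P.subs) :
    A ∈ P.subs := by
  induction P with
  | act a => simp [subs] at h
  | seq P Q ihP ihQ =>
    simp only [subs, List.mem_cons, List.mem_append, reduceCtorEq, false_or] at h ⊢
    rcases h with h | h
    · simp [ihP h]
    · simp [ihQ h]
  | loop j P ih =>
    simp only [subs, List.mem_cons, loop.injEq] at h ⊢
    rcases h with ⟨rfl, rfl⟩ | h
    · simp [self_mem_subs]
    · simp [ih h]

/-- The letters of trace words: actions, an end marker, and initial marks that distinguish the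
word variables. -/
inductive TraceLetter (R : ℕ) where
  | act (a : CounterAct (Fin (R + 1)))
  | halt
  | mark (j : Fin (R + 2))

/-- The variables of the trace grammar: `zero i` and `drop i` derive the words along which the
register `i` goes from `0` to `0`, and from its current value to one less. -/
inductive TraceVar (P : CounterProg ℕ) (R : ℕ) where
  | start
  | control
  | prog (Q : {Q // Q ∈ P.subs})
  | zero (i : Fin (R + 1))
  | drop (i : Fin (R + 1))

variable {P : CounterProg ℕ} {R : ℕ}

instance : Finite (TraceLetter R) :=
  Finite.of_surjective
    (fun x : CounterAct (Fin (R + 1)) ⊕ Unit ⊕ Fin (R + 2) =>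
      x.elim TraceLetter.act (Sum.elim (fun _ => TraceLetter.halt) TraceLetter.mark)) fun a =>
      match a with
      | .act a => ⟨.inl a, rfl⟩
      | .halt => ⟨.inr (.inl ()), rfl⟩
      | .mark j => ⟨.inr (.inr j), rfl⟩

instance : Finite (TraceVar P R) :=
  have : Finite {Q // Q ∈ P.subs} := P.subs.finite_toSet
  Finite.of_surjective
    (fun x : Bool ⊕ {Q // Q ∈ P.subs} ⊕ Fin (R + 1) ⊕ Fin (R + 1) =>
      x.elim (fun b => if b then TraceVar.start else TraceVar.control)
        (Sum.elim TraceVar.prog (Sum.elim TraceVar.zero TraceVar.drop))) fun a =>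
      match a with
      | .start => ⟨.inl true, rfl⟩
      | .control => ⟨.inl false, rfl⟩
      | .prog Q => ⟨.inr (.inl Q), rfl⟩
      | .zero i => ⟨.inr (.inr (.inl i)), rfl⟩
      | .drop i => ⟨.inr (.inr (.inr i)), rfl⟩

/-- Symbols of the trace grammar. -/
abbrev TraceSym (P : CounterProg ℕ) (R : ℕ) : Type := Symbol (TraceLetter R) (TraceVar P R)

/-- The action `a` as a terminal symbol. -/
abbrev actSym (a : CounterAct (Fin (R + 1))) : TraceSym P R := .terminal (.act a)

/-- The variable `v` as a symbol. -/
abbrev varSym (v : TraceVar P R) : TraceSym P R := .nonterminal v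

/-- The rules of the trace grammar that do not depend on the input. -/
inductive FixedRule (P : CounterProg ℕ) (R : ℕ) : TraceVar P R → List (TraceSym P R) → Prop
  | start_control : FixedRule P R .start [.terminal (.mark 0), varSym .control]
  | start_zero (i) : FixedRule P R .start [.terminal (.mark i.succ), varSym (.zero i)]
  | act (a) (h : act a ∈ P.subs) :
      FixedRule P R (.prog ⟨act a, h⟩) [actSym (a.map (Fin.ofNat (R + 1)))]
  | seq (A B) (h : seq A B ∈ P.subs) :
      FixedRule P R (.prog ⟨seq A B, h⟩)
        [varSym (.prog ⟨A, (mem_subs_of_seq_mem h).1⟩),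
          varSym (.prog ⟨B, (mem_subs_of_seq_mem h).2⟩)]
  | loop_done (i A) (h : loop i A ∈ P.subs) :
      FixedRule P R (.prog ⟨loop i A, h⟩) [actSym (.zero (Fin.ofNat (R + 1) i))]
  | loop_step (i A) (h : loop i A ∈ P.subs) :
      FixedRule P R (.prog ⟨loop i A, h⟩)
        [varSym (.prog ⟨A, mem_subs_of_loop_mem h⟩), varSym (.prog ⟨loop i A, h⟩)]
  | zero_halt (i) : FixedRule P R (.zero i) [.terminal .halt]
  | zero_zero (i) : FixedRule P R (.zero i) [actSym (.zero i), varSym (.zero i)]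
  | zero_other (i a) (h : a.reg ≠ i) : FixedRule P R (.zero i) [actSym a, varSym (.zero i)]
  | zero_inc (i) :
      FixedRule P R (.zero i) [actSym (.inc i), varSym (.drop i), varSym (.zero i)]
  | drop_dec (i) : FixedRule P R (.drop i) [actSym (.dec i)]
  | drop_other (i a) (h : a.reg ≠ i) : FixedRule P R (.drop i) [actSym a, varSym (.drop i)]
  | drop_inc (i) :
      FixedRule P R (.drop i) [actSym (.inc i), varSym (.drop i), varSym (.drop i)]

/-- The right-hand side that initializes the register `0` with `n` and runs the program. -/
def controlOutput (P : CounterProg ℕ) (R n : ℕ) : List (TraceSym P R) :=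
  List.replicate n (actSym (.inc 0)) ++
    [varSym (.prog ⟨P, P.self_mem_subs⟩), .terminal .halt]

/-- The rules of the trace grammar for the input `n`. -/
def TraceRule (P : CounterProg ℕ) (R n : ℕ) (v : TraceVar P R) (γ : List (TraceSym P R)) : Prop :=
  (v = .control ∧ γ = controlOutput P R n) ∨ FixedRule P R v γ

/-- There are finitely many symbols, and these right-hand sides have length at most `3`. The
input-dependent rule has unbounded length and is therefore kept apart. -/
theorem finite_fixedRule (P : CounterProg ℕ) (R : ℕ) :
    {p : TraceVar P R × List (TraceSym P R) | FixedRule P R p.1 p.2}.Finite := by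
  have : Finite (TraceSym P R) := Finite.of_surjective
    (fun x : TraceLetter R ⊕ TraceVar P R => x.elim Symbol.terminal Symbol.nonterminal) fun a =>
      match a with
      | .terminal a => ⟨.inl a, rfl⟩
      | .nonterminal v => ⟨.inr v, rfl⟩
  refine ((Set.finite_univ (α := TraceVar P R)).prod
    (List.finite_length_le (TraceSym P R) 3)).subset ?_
  rintro ⟨v, γ⟩ h
  refine ⟨trivial, ?_⟩
  change γ.length ≤ 3
  change FixedRule P R v γ at h
  cases h <;> simp

/-- The words that end with the end marker after the actions `u`. -/
def traceWord (u : List (CounterAct (Fin (R + 1)))) : List (TraceLetter R) :=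
  u.map .act ++ [.halt]

/-- The conditions on a sequence of actions: the first one says that it is a trace of the program
with input `n`, the others that the registers are treated correctly. -/
def Condition (P : CounterProg ℕ) (R n : ℕ) (j : Fin (R + 2))
    (u : List (CounterAct (Fin (R + 1)))) : Prop :=
  Fin.cases (motive := fun _ => Prop)
    (∃ t, P.Trace t ∧
      u = List.replicate n (.inc 0) ++ t.map (CounterAct.map (Fin.ofNat (R + 1))))
    (fun i => CounterAct.Tracks i u 0 0) j

/-- The languages of the variables. -/
def TraceLang (P : CounterProg ℕ) (R n : ℕ) : TraceVar P R → List (TraceLetter R) → Prop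
  | .start, w => ∃ j u, w = .mark j :: traceWord u ∧ Condition P R n j u
  | .control, w => ∃ u, w = traceWord u ∧ Condition P R n 0 u
  | .prog Q, w => ∃ t, Q.1.Trace t ∧ w = (t.map (CounterAct.map (Fin.ofNat (R + 1)))).map .act
  | .zero i, w => ∃ u, w = traceWord u ∧ CounterAct.Tracks i u 0 0
  | .drop i, w => ∃ u, w = u.map .act ∧ ∀ c, CounterAct.Tracks i u (c + 1) c

theorem substWords_replicate {T N : Type*} {I : N → List T → Prop} {a : T} {n : ℕ}
    {u : List (Symbol T N)} {w : List T}
    (h : SubstWords I (List.replicate n (.terminal a) ++ u) w) :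
    ∃ w', w = List.replicate n a ++ w' ∧ SubstWords I u w' := by
  induction n generalizing w with
  | zero => exact ⟨w, rfl, h⟩
  | succ n ih =>
    obtain ⟨w', rfl, h⟩ := h
    obtain ⟨w'', rfl, h'⟩ := ih h
    exact ⟨w'', rfl, h'⟩

/-- Soundness of the grammar: the intended languages are closed under every rule, so by
`LeftGen.substWords` nothing else is derivable. -/
theorem traceLang_of_rule {n : ℕ} {v : TraceVar P R} {γ : List (TraceSym P R)}
    {w : List (TraceLetter R)} (hr : TraceRule P R n v γ)
    (h : SubstWords (TraceLang P R n) γ w) : TraceLang P R n v w := by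
  rcases hr with ⟨rfl, rfl⟩ | hr
  · obtain ⟨w, rfl, w₁, w₂, rfl, ⟨t, ht, rfl⟩, w₃, rfl, rfl⟩ := substWords_replicate h
    exact ⟨_, by simp [traceWord], t, ht, rfl⟩
  · cases hr with
    | start_control =>
      obtain ⟨w', rfl, w₁, w₂, rfl, ⟨u, rfl, hu⟩, rfl⟩ := h
      exact ⟨0, u, by simp, hu⟩
    | start_zero i =>
      obtain ⟨w', rfl, w₁, w₂, rfl, ⟨u, rfl, hu⟩, rfl⟩ := h
      exact ⟨i.succ, u, by simp, by simpa [Condition] using hu⟩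
    | act a =>
      obtain ⟨w', rfl, rfl⟩ := h
      exact ⟨[a], .act a, rfl⟩
    | seq A B =>
      obtain ⟨w₁, w₂, rfl, ⟨t₁, h₁, rfl⟩, w₃, w₄, rfl, ⟨t₂, h₂, rfl⟩, rfl⟩ := h
      exact ⟨_, .seq h₁ h₂, by simp⟩
    | loop_done i A =>
      obtain ⟨w', rfl, rfl⟩ := h
      exact ⟨_, .loop_done i A, rfl⟩
    | loop_step i A =>
      obtain ⟨w₁, w₂, rfl, ⟨t₁, h₁, rfl⟩, w₃, w₄, rfl, ⟨t₂, h₂, rfl⟩, rfl⟩ := h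
      exact ⟨_, .loop_step h₁ h₂, by simp⟩
    | zero_halt i =>
      obtain ⟨w', rfl, rfl⟩ := h
      exact ⟨[], rfl, rfl⟩
    | zero_zero i =>
      obtain ⟨w', rfl, w₁, w₂, rfl, ⟨u, rfl, hu⟩, rfl⟩ := h
      exact ⟨.zero i :: u, by simp [traceWord], 0, ⟨rfl, fun _ => rfl⟩, hu⟩
    | zero_other i a ha =>
      obtain ⟨w', rfl, w₁, w₂, rfl, ⟨u, rfl, hu⟩, rfl⟩ := h
      exact ⟨a :: u, by simp [traceWord], 0, (CounterAct.upd_of_reg_ne ha _ _).2 rfl, hu⟩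
    | zero_inc i =>
      obtain ⟨w', rfl, w₁, w₂, rfl, ⟨u, rfl, hu⟩, w₃, w₄, rfl, ⟨u', rfl, hu'⟩, rfl⟩ := h
      exact ⟨.inc i :: (u ++ u'), by simp [traceWord], 1, by simp [CounterAct.Upd],
        CounterAct.tracks_append.2 ⟨0, hu 0, hu'⟩⟩
    | drop_dec i =>
      obtain ⟨w', rfl, rfl⟩ := h
      exact ⟨[.dec i], rfl, fun c => ⟨c, by simp [CounterAct.Upd], rfl⟩⟩
    | drop_other i a ha =>
      obtain ⟨w', rfl, w₁, w₂, rfl, ⟨u, rfl, hu⟩, rfl⟩ := h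
      exact ⟨a :: u, by simp, fun c => ⟨c + 1, (CounterAct.upd_of_reg_ne ha _ _).2 rfl, hu c⟩⟩
    | drop_inc i =>
      obtain ⟨w', rfl, w₁, w₂, rfl, ⟨u, rfl, hu⟩, w₃, w₄, rfl, ⟨u', rfl, hu'⟩, rfl⟩ := h
      exact ⟨.inc i :: (u ++ u'), by simp, fun c => ⟨c + 2, by simp [CounterAct.Upd],
        CounterAct.tracks_append.2 ⟨c + 1, hu _, hu' c⟩⟩⟩

theorem leftGen_prog (n : ℕ) {Q : CounterProg ℕ} {t : List (CounterAct ℕ)} (ht : Q.Trace t)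
    (hQ : Q ∈ P.subs) :
    LeftGen (TraceRule P R n) [varSym (.prog ⟨Q, hQ⟩)]
      ((t.map (CounterAct.map (Fin.ofNat (R + 1)))).map .act) := by
  induction ht with
  | act a => exact .of_rule (.inr (.act a hQ)) (.terminal _ .nil)
  | seq _ _ ihA ihB =>
    simp only [List.map_append]
    exact .of_rule (.inr (.seq _ _ hQ)) ((ihA _).append (ihB _))
  | loop_done i A => exact .of_rule (.inr (.loop_done i A hQ)) (.terminal _ .nil)
  | loop_step _ _ ihA ihB =>
    simp only [List.map_append]
    exact .of_rule (.inr (.loop_step _ _ hQ)) ((ihA _).append (ihB _))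

theorem leftGen_control {n : ℕ} {u : List (CounterAct (Fin (R + 1)))}
    (hu : Condition P R n 0 u) :
    LeftGen (TraceRule P R n) [varSym .control] (traceWord u) := by
  obtain ⟨t, ht, rfl⟩ := hu
  refine .of_rule (.inl ⟨rfl, rfl⟩) ?_
  have h := (LeftGen.map_terminal (R := TraceRule P R n)
    (List.replicate n (TraceLetter.act (R := R) (.inc 0)))).append
      ((leftGen_prog n ht P.self_mem_subs).append (.terminal TraceLetter.halt .nil))
  simpa [controlOutput, traceWord] using h

/-- The sentential form is a pushdown that stores the register in unary: one `drop i` for each unit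
above the bottom symbol `zero i`. An increment adds a `drop i`, a decrement removes one, and a zero
test is possible only at the bottom. The induction needs an arbitrary content `c`. -/
theorem leftGen_zero (n : ℕ) {i : Fin (R + 1)} {u : List (CounterAct (Fin (R + 1)))} {c : ℕ}
    (hu : CounterAct.Tracks i u c 0) :
    LeftGen (TraceRule P R n) (List.replicate c (varSym (.drop i)) ++ [varSym (.zero i)])
      (traceWord u) := by
  induction u generalizing c with
  | nil =>
    obtain rfl : 0 = c := hu
    exact .of_rule (.inr (.zero_halt i)) (.terminal _ .nil)
  | cons a u ih =>
    obtain ⟨d, ha, hd⟩ := hu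
    specialize ih hd
    by_cases hai : a.reg = i
    · cases a with
      | inc j =>
        obtain rfl : j = i := hai
        obtain rfl : d = c + 1 := by simpa [CounterAct.Upd] using ha
        cases c with
        | zero => exact .of_rule (.inr (.zero_inc j)) (.terminal _ ih)
        | succ c => exact .nonterminal (.inr (.drop_inc j)) (.terminal _ ih)
      | dec j =>
        obtain rfl : j = i := hai
        obtain rfl : c = d + 1 := by simpa [CounterAct.Upd] using ha
        exact .nonterminal (.inr (.drop_dec j)) (.terminal _ ih)
      | zero j =>
        obtain rfl : j = i := hai
        obtain ⟨rfl, rfl⟩ : d = c ∧ c = 0 := by simpa [CounterAct.Upd] using ha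
        exact .of_rule (.inr (.zero_zero j)) (.terminal _ ih)
    · obtain rfl : d = c := (CounterAct.upd_of_reg_ne hai _ _).1 ha
      cases d with
      | zero => exact .of_rule (.inr (.zero_other i a hai)) (.terminal _ ih)
      | succ c => exact .nonterminal (.inr (.drop_other i a hai)) (.terminal _ ih)

theorem leftGen_start {n : ℕ} {j : Fin (R + 2)} {u : List (CounterAct (Fin (R + 1)))}
    (hu : Condition P R n j u) :
    LeftGen (TraceRule P R n) [varSym .start] (.mark j :: traceWord u) := by
  induction j using Fin.cases with
  | zero => exact .of_rule (.inr .start_control) (.terminal _ (leftGen_control hu))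
  | succ i =>
    exact .of_rule (.inr (.start_zero i)) (.terminal _ (leftGen_zero (c := 0) n hu))

/-- Traces disregard the contents of registers, so every loop may be left at once. -/
theorem exists_trace (Q : CounterProg ℕ) : ∃ t, Q.Trace t := by
  induction Q with
  | act a => exact ⟨_, .act a⟩
  | seq A B ihA ihB =>
    obtain ⟨t, ht⟩ := ihA
    obtain ⟨t', ht'⟩ := ihB
    exact ⟨_, .seq ht ht'⟩
  | loop i A => exact ⟨_, .loop_done i A⟩

theorem exists_leftGen (n : ℕ) (v : TraceVar P R) :
    ∃ w, LeftGen (TraceRule P R n) [varSym v] w := by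
  have hz : ∀ i, LeftGen (TraceRule P R n) [varSym (.zero i)] (traceWord []) :=
    fun i => leftGen_zero (c := 0) n rfl
  cases v with
  | start => exact ⟨_, .of_rule (.inr (.start_zero 0)) (.terminal _ (hz 0))⟩
  | control =>
    obtain ⟨t, ht⟩ := P.exists_trace
    exact ⟨_, leftGen_control ⟨t, ht, rfl⟩⟩
  | prog Q =>
    obtain ⟨t, ht⟩ := Q.1.exists_trace
    exact ⟨_, leftGen_prog n ht Q.2⟩
  | zero i => exact ⟨_, hz i⟩
  | drop i => exact ⟨_, .of_rule (.inr (.drop_dec i)) (.terminal _ .nil)⟩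

/-- A property of variables that holds for the initial one and is inherited along the rules holds
for all of them. -/
theorem traceVar_induction {n : ℕ} {p : TraceVar P R → Prop} (start : p .start)
    (step : ∀ v γ v', TraceRule P R n v γ → varSym v' ∈ γ → p v → p v') (v : TraceVar P R) :
    p v := by
  have hz : ∀ i, p (.zero i) := fun i => step _ _ _ (.inr (.start_zero i)) (by simp) start
  have hc : p .control := step _ _ _ (.inr .start_control) (by simp) start
  have hP : p (.prog ⟨P, P.self_mem_subs⟩) :=
    step _ _ _ (.inl ⟨rfl, rfl⟩) (by simp [controlOutput]) hc
  -- The property descends from a program to its subprograms along the rules for `seq` and `loop`.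
  have hsub : ∀ (Q : CounterProg ℕ) (hQ : Q ∈ P.subs), p (.prog ⟨Q, hQ⟩) →
      ∀ Q' ∈ Q.subs, ∀ hQ' : Q' ∈ P.subs, p (.prog ⟨Q', hQ'⟩) := by
    intro Q
    induction Q with
    | act a =>
      intro hQ h Q' h' hQ'
      obtain rfl : Q' = _ := by simpa [subs] using h'
      exact h
    | seq A B ihA ihB =>
      intro hQ h Q' h' hQ'
      simp only [subs, List.mem_cons, List.mem_append] at h'
      rcases h' with rfl | h' | h'
      · exact h
      · exact ihA (mem_subs_of_seq_mem hQ).1 (step _ _ _ (.inr (.seq A B hQ)) (by simp) h) Q' h' hQ'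
      · exact ihB (mem_subs_of_seq_mem hQ).2 (step _ _ _ (.inr (.seq A B hQ)) (by simp) h) Q' h' hQ'
    | loop i A ih =>
      intro hQ h Q' h' hQ'
      simp only [subs, List.mem_cons] at h'
      rcases h' with rfl | h'
      · exact h
      · exact ih (mem_subs_of_loop_mem hQ) (step _ _ _ (.inr (.loop_step i A hQ)) (by simp) h)
          Q' h' hQ'
  cases v with
  | start => exact start
  | control => exact hc
  | prog Q => exact hsub P P.self_mem_subs hP Q.1 Q.2 Q.2
  | zero i => exact hz i
  | drop i => exact step _ _ _ (.inr (.zero_inc i)) (by simp) (hz i)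

theorem TraceRule.output_ne_nil {n : ℕ} {v : TraceVar P R} {γ : List (TraceSym P R)}
    (h : TraceRule P R n v γ) : γ ≠ [] := by
  rcases h with ⟨rfl, rfl⟩ | h
  · simp [controlOutput]
  · cases h <;> simp

end CounterProg

/-! ### Satisfaction of `∃*∀` conditions -/

namespace CFHG

theorem getElem_wordAssignment {A : Type} {k : ℕ} (u : Fin k → List (Option A)) (i : ℕ)
    (h : i < (wordAssignment u).length) :
    (wordAssignment u)[i] = fun x => ((u x)[i]?).getD none :=
  List.getElem_ofFn _

/-- At least one word variable is needed: without any, the maximal length is `0` and the length of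
`W` is lost. -/
theorem wordAssignment_columns {A : Type} {k : ℕ} (W : List (Fin (k + 1) → Option A)) :
    wordAssignment (fun x => W.map fun σ => σ x) = W := by
  have hlen : (Finset.univ.sup fun x : Fin (k + 1) => (W.map fun σ => σ x).length) = W.length := by
    simp only [List.length_map]
    exact Finset.sup_const Finset.univ_nonempty _
  refine List.ext_getElem (by simp only [wordAssignment, List.length_ofFn, hlen]) fun i h₁ h₂ => ?_
  funext x
  rw [getElem_wordAssignment]
  simp [List.getElem?_eq_getElem h₂]

/-- A word shorter than the maximum would be padded, and the padding would show as a `#` in the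
letter at the index of its length. -/
theorem eq_columns_of_wordAssignment {A : Type} {k : ℕ} (u : Fin k → List (Option A))
    (h : ∀ σ ∈ wordAssignment u, ∀ x, σ x ≠ none) (x : Fin k) :
    u x = (wordAssignment u).map fun σ => σ x := by
  have hle : (u x).length ≤ Finset.univ.sup fun x => (u x).length :=
    Finset.le_sup (f := fun x => (u x).length) (Finset.mem_univ x)
  have hlen : (u x).length = (wordAssignment u).length := by
    simp only [wordAssignment, List.length_ofFn]
    refine le_antisymm hle (not_lt.1 fun hlt => ?_)
    refine h _ (List.mem_ofFn.2 ⟨⟨(u x).length, hlt⟩, rfl⟩) x ?_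
    simp
  refine List.ext_getElem (by simpa using hlen) fun i h₁ h₂ => ?_
  simp [getElem_wordAssignment, List.getElem?_eq_getElem h₁]

variable {G : CFHG} {L : Language (Fin G.numLetters)} {y : Fin G.numWordVars}

/-- The variables are distinct, so no later choice overwrites an earlier one, and a single
assignment `u'` collects all existential witnesses before the universal word is given. -/
theorem exists_of_sat {xs : List (Fin G.numWordVars)} (hxs : xs.Nodup)
    {u : Fin G.numWordVars → List (Option (Fin G.numLetters))}
    (h : G.Sat L (xs.map (fun x => (.ex, x)) ++ [(.all, y)]) u) :
    ∃ u' : Fin G.numWordVars → List (Option (Fin G.numLetters)),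
      (∀ x ∈ xs, (u' x).reduceOption ∈ L) ∧ (∀ x ∉ xs, u' x = u x) ∧
      ∀ w ∈ L, ∃ w' ∈ paddings w, wordAssignment (update u' y w') ∈ G.underlying.language := by
  induction xs generalizing u with
  | nil => exact ⟨u, by simp, by simp, h⟩
  | cons x xs ih =>
    obtain ⟨w, hw, w', hw', h⟩ := h
    obtain ⟨hx, hxs⟩ := List.nodup_cons.1 hxs
    obtain ⟨u', h₁, h₂, h₃⟩ := ih hxs h
    refine ⟨u', ?_, ?_, h₃⟩
    · rintro z hz
      rcases List.mem_cons.1 hz with rfl | hz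
      · rw [h₂ z hx, update_self, show w'.reduceOption = w from hw']
        exact hw
      · exact h₁ z hz
    · intro z hz
      rw [List.mem_cons, not_or] at hz
      rw [h₂ z hz.2, update_of_ne hz.1]

theorem sat_of_forall {xs : List (Fin G.numWordVars)}
    {u u' : Fin G.numWordVars → List (Option (Fin G.numLetters))}
    (h₁ : ∀ x ∈ xs, (u' x).reduceOption ∈ L) (h₂ : ∀ x ∉ xs, u' x = u x)
    (h₃ : ∀ w ∈ L, ∃ w' ∈ paddings w, wordAssignment (update u' y w') ∈ G.underlying.language) :
    G.Sat L (xs.map (fun x => (.ex, x)) ++ [(.all, y)]) u := by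
  induction xs generalizing u with
  | nil =>
    obtain rfl : u' = u := funext fun x => h₂ x (by simp)
    exact h₃
  | cons x xs ih =>
    refine ⟨_, h₁ x (by simp), u' x, rfl, ih (fun z hz => h₁ z (by simp [hz])) fun z hz => ?_⟩
    by_cases hzx : z = x
    · subst hzx
      simp
    · rw [update_of_ne hzx, h₂ z (by simp [hz, hzx])]

/-- A hypergrammar without `#` in its rules is ranked. -/
theorem isRanked_of_forall_ne_none
    (h : ∀ r ∈ G.rules, ∀ σ, Symbol.terminal σ ∈ r.output → ∀ x, σ x ≠ none) : G.IsRanked := by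
  intro r hr
  rw [List.isChain_iff_forall_rel_of_append_cons_cons]
  rintro a b l₁ l₂ hout x hx
  -- Right ranks are empty: a right path that ends in a sequence with a final letter either has
  -- length zero or ends in a right-hand side, and in both cases that letter occurs in a rule.
  exfalso
  simp only [rightRank, Set.mem_iUnion] at hx
  obtain ⟨σ, γ, hreach, hx⟩ := hx
  rcases Relation.ReflTransGen.cases_tail hreach with heq | ⟨c, -, hedge⟩
  · have : Symbol.terminal σ ∈ [a] := by rw [← heq]; simp
    rw [List.mem_singleton] at this
    exact h r hr σ (by simp [hout, this]) x hx
  · generalize hz : γ ++ [Symbol.terminal σ] = z at hedge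
    cases hedge with
    | rule r' hr' => exact h r' hr' σ (by rw [← hz]; simp) x hx
    | last r' hr' v δ hδ =>
      have : Symbol.terminal σ ∈ [(Symbol.nonterminal v : G.Sym)] := by rw [← hz]; simp
      simp at this

theorem mem_underlying_rules {r : ContextFreeRule G.Letter (Fin G.numVars)} :
    r ∈ G.underlying.rules ↔ r ∈ G.rules :=
  List.mem_toFinset (α := ContextFreeRule G.Letter (Fin G.numVars))

theorem exists_derives_of_mem_output {r : ContextFreeRule G.Letter (Fin G.numVars)}
    (hr : r ∈ G.rules) {s β δ : List G.Sym} {v : Fin G.numVars}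
    (h : G.underlying.Derives s (β ++ [Symbol.nonterminal r.input] ++ δ))
    (hv : Symbol.nonterminal v ∈ r.output) :
    ∃ β' δ' : List G.Sym, G.underlying.Derives s (β' ++ [Symbol.nonterminal v] ++ δ') := by
  obtain ⟨γ₁, γ₂, hγ⟩ := List.append_of_mem hv
  refine ⟨β ++ γ₁, γ₂ ++ δ, h.trans_produces ⟨r, mem_underlying_rules.2 hr, ?_⟩⟩
  have := ContextFreeRule.rewrites_of_exists_parts r β δ
  have e : β ++ r.output ++ δ = β ++ γ₁ ++ [Symbol.nonterminal v] ++ (γ₂ ++ δ) := by simp [hγ]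
  rwa [e] at this

end CFHG

theorem SubstWords.exists_of_rename {T T' N N' : Type*} {I : N → List T → Prop} (f : T → T')
    (e : N ≃ N') {γ : List (Symbol T N)} {W : List T'}
    (h : SubstWords (fun v W => ∃ w, W = w.map f ∧ I (e.symm v) w)
      (γ.map (Symbol.rename f e)) W) : ∃ w, W = w.map f ∧ SubstWords I γ w := by
  induction γ generalizing W with
  | nil => exact ⟨[], h, rfl⟩
  | cons x γ ih =>
    rcases x with a | v
    · obtain ⟨W', rfl, h⟩ := h
      obtain ⟨w, rfl, hw⟩ := ih h
      exact ⟨a :: w, rfl, w, rfl, hw⟩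
    · obtain ⟨W₁, W₂, rfl, ⟨w₁, rfl, h₁⟩, h⟩ := h
      obtain ⟨w, rfl, hw⟩ := ih h
      exact ⟨w₁ ++ w, by simp, w₁, w, rfl, by simpa using h₁, hw⟩

namespace CounterProg

variable {P : CounterProg ℕ} {R : ℕ}

/-! ### The hypergrammar of a counter program -/

/-- The letter of the word variable `x` in the letter `t` of the trace grammar: the existential
variables always have their own marks. -/
def TraceLetter.component (t : TraceLetter R) (x : Fin (R + 3)) : TraceLetter R :=
  Fin.lastCases (motive := fun _ => TraceLetter R) t
    (fun j => match t with
      | .mark _ => .mark j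
      | t => t) x

/-- Numbering of the letters. -/
noncomputable def letterEquiv (R : ℕ) : TraceLetter R ≃ Fin (Nat.card (TraceLetter R)) :=
  Finite.equivFin _

/-- Numbering of the variables. -/
noncomputable def varEquiv (P : CounterProg ℕ) (R : ℕ) :
    TraceVar P R ≃ Fin (Nat.card (TraceVar P R)) :=
  Finite.equivFin _

/-- The letter `t` as a letter of the hypergrammar. -/
noncomputable def tupleLetter (t : TraceLetter R) :
    Fin (R + 3) → Option (Fin (Nat.card (TraceLetter R))) :=
  fun x => some (letterEquiv R (t.component x))

/-- A rule of the trace grammar as a rule of the hypergrammar. -/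
noncomputable def tupleRule (p : TraceVar P R × List (TraceSym P R)) :
    ContextFreeRule (Fin (R + 3) → Option (Fin (Nat.card (TraceLetter R))))
      (Fin (Nat.card (TraceVar P R))) :=
  ⟨varEquiv P R p.1, p.2.map (Symbol.rename tupleLetter (varEquiv P R))⟩

/-- The hypergrammar for the program `P` with input `n`. -/
noncomputable def hypergrammar (P : CounterProg ℕ) (R n : ℕ) : CFHG where
  numLetters := Nat.card (TraceLetter R)
  numWordVars := R + 3
  numVars := Nat.card (TraceVar P R)
  quant := Fin.lastCases (motive := fun _ => Quantifier) .all fun _ => .ex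
  start := varEquiv P R .start
  rules := tupleRule (.control, controlOutput P R n) ::
    ((finite_fixedRule P R).toFinset.toList.map tupleRule)

theorem mem_hypergrammar_rules {n : ℕ} {r} :
    r ∈ (hypergrammar P R n).rules ↔ ∃ v γ, TraceRule P R n v γ ∧ r = tupleRule (v, γ) := by
  refine List.mem_cons.trans ?_
  constructor
  · rintro (rfl | h)
    · exact ⟨_, _, .inl ⟨rfl, rfl⟩, rfl⟩
    · obtain ⟨p, hp, rfl⟩ := List.mem_map.1 h
      exact ⟨p.1, p.2, .inr (by simpa using hp), rfl⟩
  · rintro ⟨v, γ, ⟨rfl, rfl⟩ | h, rfl⟩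
    · exact .inl rfl
    · exact .inr (List.mem_map.2 ⟨(v, γ), by simpa using h, rfl⟩)

theorem derives_hypergrammar_of_leftGen {n : ℕ} {v : TraceVar P R} {w : List (TraceLetter R)}
    (h : LeftGen (TraceRule P R n) [varSym v] w) :
    (hypergrammar P R n).underlying.Derives [Symbol.nonterminal (varEquiv P R v)]
      ((w.map tupleLetter).map Symbol.terminal) := by
  refine (ContextFreeGrammar.derives_iff_leftGen _ _ _).2 ?_
  refine LeftGen.rename (R' := fun v γ => ⟨v, γ⟩ ∈ (hypergrammar P R n).underlying.rules)
    tupleLetter (varEquiv P R) (fun v γ hr => ?_) h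
  exact CFHG.mem_underlying_rules.2 (mem_hypergrammar_rules.2 ⟨v, γ, hr, rfl⟩)

/-- One inclusion pulls a derivation back to the trace grammar and uses the soundness of its rules,
the other renames the derivation given by `leftGen_start`. -/
theorem mem_hypergrammar_language {n : ℕ} {W : List (hypergrammar P R n).Letter} :
    W ∈ (hypergrammar P R n).underlying.language ↔
      ∃ j u, W = ((.mark j :: traceWord u).map tupleLetter) ∧ Condition P R n j u := by
  constructor
  · intro h
    have h' := ((hypergrammar P R n).underlying.derives_iff_leftGen _ _).1 h
    have := h'.substWords
      (I := fun v W => ∃ w, W = w.map tupleLetter ∧ TraceLang P R n ((varEquiv P R).symm v) w) ?_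
    · obtain ⟨W₁, W₂, rfl, ⟨w, rfl, hw⟩, rfl⟩ := this
      have hs : (varEquiv P R).symm (hypergrammar P R n).underlying.initial = .start :=
        (varEquiv P R).symm_apply_apply _
      rw [hs] at hw
      obtain ⟨j, u, rfl, hu⟩ := hw
      exact ⟨j, u, List.append_nil _, hu⟩
    · intro v γ W hr hW
      obtain ⟨v', γ', hr', heq⟩ := mem_hypergrammar_rules.1 (CFHG.mem_underlying_rules.1 hr)
      obtain rfl : v = varEquiv P R v' := congrArg ContextFreeRule.input heq
      obtain rfl : γ = γ'.map (Symbol.rename tupleLetter (varEquiv P R)) :=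
        congrArg ContextFreeRule.output heq
      obtain ⟨w, rfl, hw⟩ := SubstWords.exists_of_rename (I := TraceLang P R n) _ _ hW
      refine ⟨w, rfl, ?_⟩
      have hs : (varEquiv P R).symm (varEquiv P R v') = v' := (varEquiv P R).symm_apply_apply _
      rw [hs]
      exact traceLang_of_rule hr' hw
  · rintro ⟨j, u, rfl, hu⟩
    exact derives_hypergrammar_of_leftGen (leftGen_start hu)

theorem isExistsForall_hypergrammar (n : ℕ) : (hypergrammar P R n).IsExistsForall := by
  refine ⟨R + 2, 1, ?_⟩
  change List.ofFn (Fin.lastCases (motive := fun _ => Quantifier) .all fun _ => .ex) = _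
  rw [List.ofFn_succ']
  simp only [Fin.lastCases_castSucc, Fin.lastCases_last, List.ofFn_const, List.concat_eq_append,
    List.replicate_one]

theorem isReduced_hypergrammar (n : ℕ) : (hypergrammar P R n).IsReduced where
  productive v := by
    obtain ⟨v, rfl⟩ := (varEquiv P R).surjective v
    obtain ⟨w, hw⟩ := exists_leftGen n v
    exact ⟨w.map tupleLetter, derives_hypergrammar_of_leftGen hw⟩
  reachable v := by
    obtain ⟨v, rfl⟩ := (varEquiv P R).surjective v
    have key : ∀ v' : TraceVar P R, ∃ β γ : List (hypergrammar P R n).Sym,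
        (hypergrammar P R n).underlying.Derives
          [Symbol.nonterminal (hypergrammar P R n).start]
          (β ++ [Symbol.nonterminal (varEquiv P R v')] ++ γ) := by
      refine traceVar_induction (n := n) ⟨[], [], Relation.ReflTransGen.refl⟩ ?_
      rintro v γ v' hr hv' ⟨β, δ, h⟩
      exact CFHG.exists_derives_of_mem_output (r := tupleRule (v, γ))
        (mem_hypergrammar_rules.2 ⟨v, γ, hr, rfl⟩) h (List.mem_map.2 ⟨_, hv', rfl⟩)
    exact key v
  empty_rule r hr h := by
    obtain ⟨v, γ, hr', rfl⟩ := mem_hypergrammar_rules.1 hr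
    exact absurd (List.map_eq_nil_iff.1 h) hr'.output_ne_nil

theorem isRanked_hypergrammar (n : ℕ) : (hypergrammar P R n).IsRanked := by
  refine CFHG.isRanked_of_forall_ne_none fun r hr σ hσ x => ?_
  obtain ⟨v, γ, hr, rfl⟩ := mem_hypergrammar_rules.1 hr
  obtain ⟨s, -, hs⟩ := List.mem_map.1 hσ
  rcases s with t | v
  · obtain rfl : tupleLetter t = σ := Symbol.terminal.inj hs
    exact Option.some_ne_none _
  · cases hs

end CounterProg

/-! ### Nonemptiness of the hyperlanguage as a common solution of all conditions -/

namespace CounterProg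

variable {P : CounterProg ℕ} {R : ℕ}

theorem component_last (t : TraceLetter R) : t.component (Fin.last (R + 2)) = t := by
  simp [TraceLetter.component]

theorem component_mark_castSucc (i j : Fin (R + 2)) :
    (TraceLetter.mark i).component j.castSucc = .mark j := by
  simp [TraceLetter.component]

theorem traceWord_map_component (u : List (CounterAct (Fin (R + 1)))) (x : Fin (R + 3)) :
    (traceWord u).map (fun t => t.component x) = traceWord u := by
  induction x using Fin.lastCases <;> simp [traceWord, TraceLetter.component]

theorem traceWord_injective : Injective (traceWord (R := R)) := by
  intro u u' h
  exact List.map_injective_iff.2 (fun a b hab => by cases hab; rfl)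
    (List.append_cancel_right h)

/-- The word of the variable with mark `j`. -/
noncomputable def markedWord (j : Fin (R + 2)) (u : List (CounterAct (Fin (R + 1)))) :
    List (Fin (Nat.card (TraceLetter R))) :=
  (TraceLetter.mark j :: traceWord u).map (letterEquiv R)

theorem markedWord_inj {j j' : Fin (R + 2)} {u u' : List (CounterAct (Fin (R + 1)))}
    (h : markedWord j u = markedWord j' u') : j = j' ∧ u = u' := by
  have h' := List.map_injective_iff.2 (letterEquiv R).injective h
  simp only [List.cons.injEq, TraceLetter.mark.injEq] at h'
  exact ⟨h'.1, traceWord_injective h'.2⟩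

theorem column_castSucc (i j : Fin (R + 2)) (u : List (CounterAct (Fin (R + 1)))) :
    ((TraceLetter.mark i :: traceWord u).map tupleLetter).map (fun σ => σ j.castSucc) =
      (markedWord j u).map some := by
  have := congrArg (List.map fun t => some (letterEquiv R t))
    (traceWord_map_component u j.castSucc)
  simp only [List.map_map] at this
  simp only [markedWord, List.map_cons, List.map_map, tupleLetter, component_mark_castSucc]
  exact congrArg _ this

theorem column_last (i : Fin (R + 2)) (u : List (CounterAct (Fin (R + 1)))) :
    ((TraceLetter.mark i :: traceWord u).map tupleLetter).map (fun σ => σ (Fin.last (R + 2))) =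
      (markedWord i u).map some := by
  simp only [markedWord, List.map_map]
  refine List.map_congr_left fun t _ => ?_
  simp [tupleLetter, component_last]

theorem reduceOption_map_some {A : Type*} (w : List A) : (w.map some).reduceOption = w := by
  simp [List.reduceOption]

theorem condition_hypergrammar (n : ℕ) :
    (hypergrammar P R n).condition =
      (List.ofFn fun j : Fin (R + 2) => (j.castSucc : Fin (R + 3))).map (fun x => (.ex, x)) ++
        [(.all, Fin.last (R + 2))] := by
  change List.ofFn (fun x : Fin (R + 3) =>
    (Fin.lastCases (motive := fun _ => Quantifier) Quantifier.all (fun _ => .ex) x, x)) = _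
  rw [List.ofFn_succ', List.map_ofFn]
  simp only [Fin.lastCases_castSucc, Fin.lastCases_last, List.concat_eq_append]
  rfl

theorem nonempty_hyperlanguage_iff (n : ℕ) :
    (hypergrammar P R n).hyperlanguage.Nonempty ↔ ∃ u, ∀ j, Condition P R n j u := by
  constructor
  · rintro ⟨L, -, hL⟩
    rw [condition_hypergrammar] at hL
    obtain ⟨u', h₁, -, h₃⟩ := CFHG.exists_of_sat (G := hypergrammar P R n)
      (List.nodup_ofFn.2 (Fin.castSucc_injective _)) hL
    have key : ∀ j : Fin (R + 2), ∃ u, Condition P R n j u ∧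
        ∀ j' : Fin (R + 2), u' j'.castSucc = (markedWord j' u).map some := by
      intro j
      -- The universal variable is instantiated with the word chosen for the existential variable
      -- `j`.
      obtain ⟨w', hw', hW⟩ := h₃ _ (h₁ j.castSucc (List.mem_ofFn.2 ⟨j, rfl⟩))
      obtain ⟨i, u, hW, hu⟩ := mem_hypergrammar_language.1 hW
      have hcol := CFHG.eq_columns_of_wordAssignment (update u' (Fin.last (R + 2)) w') (by
        rw [hW]
        intro σ hσ x
        obtain ⟨t, -, rfl⟩ := List.mem_map.1 hσ
        exact Option.some_ne_none _)
      rw [hW] at hcol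
      have hu' : ∀ j' : Fin (R + 2), u' j'.castSucc = (markedWord j' u).map some := by
        intro j'
        refine Eq.trans ?_ ((hcol j'.castSucc).trans (column_castSucc i j' u))
        exact (update_of_ne (Fin.castSucc_lt_last j').ne _ _).symm
      have hl : w' = (markedWord i u).map some :=
        (update_self (Fin.last (R + 2)) w' u').symm.trans
          ((hcol (Fin.last (R + 2))).trans (column_last i u))
      -- The word of the universal variable reveals the condition `i` that was checked; as this word
      -- has mark `j`, the two agree.
      have hij : markedWord i u = markedWord j u := by
        have : w'.reduceOption = (u' j.castSucc).reduceOption := hw'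
        rw [hl, hu' j] at this
        exact (reduceOption_map_some _).symm.trans (this.trans (reduceOption_map_some _))
      obtain rfl := (markedWord_inj hij).1
      exact ⟨u, hu, hu'⟩
    obtain ⟨u, -, hu⟩ := key 0
    refine ⟨u, fun j => ?_⟩
    -- The trace for `j` equals that for `0`, since both are read off the same existential word.
    obtain ⟨u₂, h, hu₂⟩ := key j
    have := (hu 0).symm.trans (hu₂ 0)
    obtain rfl := (markedWord_inj (List.map_injective_iff.2 (Option.some_injective _) this)).2
    exact h
  · rintro ⟨u, hu⟩
    refine ⟨{w | ∃ j : Fin (R + 2), w = markedWord j u}, ⟨_, 0, rfl⟩, ?_⟩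
    rw [condition_hypergrammar]
    refine CFHG.sat_of_forall (G := hypergrammar P R n)
      -- The empty word at the universal variable matches the initial assignment; it is overwritten
      -- when that variable is quantified.
      (u' := Fin.lastCases (motive := fun _ => List (Option (Fin (Nat.card (TraceLetter R))))) []
        fun j => (markedWord j u).map some) ?_ ?_ ?_
    · intro x hx
      obtain ⟨j, rfl⟩ := List.mem_ofFn.1 hx
      refine ⟨j, ?_⟩
      rw [Fin.lastCases_castSucc]
      exact reduceOption_map_some _
    · intro x hx
      induction x using Fin.lastCases with
      | last => exact Fin.lastCases_last ..
      | cast j => exact absurd (List.mem_ofFn.2 ⟨j, rfl⟩) hx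
    · rintro w ⟨j, rfl⟩
      refine ⟨(markedWord j u).map some, reduceOption_map_some _, ?_⟩
      refine mem_hypergrammar_language.2 ⟨j, u, ?_, hu j⟩
      refine Eq.trans ?_ (CFHG.wordAssignment_columns (k := R + 2) _)
      congr 1
      funext x
      induction x using Fin.lastCases with
      | last => exact (update_self ..).trans (column_last j u).symm
      | cast i =>
        refine (update_of_ne (Fin.castSucc_lt_last i).ne _ _).trans ?_
        exact (Fin.lastCases_castSucc ..).trans (column_castSucc j i u).symm

theorem nonempty_hyperlanguage_iff_run (hR : ∀ w, P.Trace w → ∀ a ∈ w, a.reg < R) (n : ℕ) :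
    (hypergrammar P R n).hyperlanguage.Nonempty ↔ P.Run (update 0 0 n) 0 := by
  rw [nonempty_hyperlanguage_iff, run_zero_iff hR]
  simp only [Fin.forall_fin_succ (n := R + 1)]
  constructor
  · rintro ⟨u, ⟨t, ht, rfl⟩, hu⟩
    exact ⟨t, ht, hu⟩
  · rintro ⟨t, ht, h⟩
    exact ⟨_, ⟨t, ht, rfl⟩, h⟩

/-! ### Computability of the reduction -/

theorem computable_replicate {α : Type*} [Primcodable α] (a : α) :
    Computable fun n : ℕ => List.replicate n a := by
  have : Primrec fun n : ℕ => (List.range n).map fun _ => a :=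
    Primrec.list_map Primrec.list_range (Primrec.const a).to₂
  refine this.to_comp.of_eq fun n => ?_
  simp

/-- The numberings of letters and variables are chosen noncomputably, but they do not depend on `n`.
Only the rule for `control` varies, by its number of initial increments; the rest of the code is a
constant. -/
theorem computable_encode_hypergrammar (P : CounterProg ℕ) (R : ℕ) :
    Computable fun n => (hypergrammar P R n).encode := by
  have hrule : Computable fun n =>
      CFHG.ruleCode (tupleRule (P := P) (R := R) (.control, controlOutput P R n)) := by
    refine (Computable.pair (.const (varEquiv P R .control : ℕ))
      (Computable.list_append.comp
        (computable_replicate (CFHG.symCode (n := Nat.card (TraceVar P R))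
          (.terminal (tupleLetter (.act (R := R) (.inc 0))))))
        (.const [CFHG.symCode (Symbol.rename (tupleLetter (R := R)) (varEquiv P R)
            (varSym (.prog ⟨P, P.self_mem_subs⟩))),
          CFHG.symCode (Symbol.rename (tupleLetter (R := R)) (varEquiv P R) (.terminal .halt))]))).of_eq
      fun n => ?_
    simp [CFHG.ruleCode, tupleRule, controlOutput, Symbol.rename]
  have hconst : ∀ n, (hypergrammar P R n).encode =
      ((hypergrammar P R 0).numLetters, (hypergrammar P R 0).numVars,
        (hypergrammar P R 0).encode.2.2.1, ((hypergrammar P R 0).start : ℕ),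
        CFHG.ruleCode (tupleRule (P := P) (R := R) (.control, controlOutput P R n)) ::
          ((finite_fixedRule P R).toFinset.toList.map tupleRule).map CFHG.ruleCode) :=
    fun _ => rfl
  refine Computable.of_eq ?_ fun n => (hconst n).symm
  exact (Computable.const _).pair ((Computable.const _).pair ((Computable.const _).pair
    ((Computable.const _).pair (Computable.list_cons.comp hrule (.const _)))))

end CounterProg

/-! ### Reduction from the halting problem -/

theorem mainTheorem4 :
    ¬ CFHG.DecidableOn {G : CFHG | G.IsExistsForall ∧ G.IsSync}
      (fun G => G.hyperlanguage.Nonempty) := by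
  rintro ⟨f, hf, hdec⟩
  -- The machine itself is the input of a universal function, so one program `P` and one bound `R`
  -- serve for all machines.
  have hpart : Partrec fun m : ℕ => (Denumerable.ofNat Nat.Partrec.Code m).eval 0 :=
    Nat.Partrec.Code.eval_part.comp (Computable.ofNat _) (.const 0)
  obtain ⟨P, hP⟩ := CounterProg.exists_prog_of_partrec hpart
  obtain ⟨R, hR⟩ := P.exists_reg_bound
  refine ComputablePred.halting_problem 0 ?_
  classical
  refine ⟨inferInstance, ?_⟩
  have hcomp : Computable fun c : Nat.Partrec.Code =>
      (CounterProg.hypergrammar P R (Encodable.encode c)).encode :=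
    (CounterProg.computable_encode_hypergrammar P R).comp .encode
  -- The algorithm `f` may diverge in general, but on the codes produced here it halts with the
  -- right answer, so the composite is a total decision procedure for halting.
  refine (hf.comp hcomp).of_eq fun c => ?_
  obtain ⟨b, hb, hiff⟩ := hdec (CounterProg.hypergrammar P R (Encodable.encode c))
    ⟨CounterProg.isExistsForall_hypergrammar _, CounterProg.isReduced_hypergrammar _,
      CounterProg.isRanked_hypergrammar _⟩
  beta_reduce at hiff
  rw [CounterProg.nonempty_hyperlanguage_iff_run hR, ← hP, Denumerable.ofNat_encode] at hiff
  rw [Part.eq_some_iff.2 hb]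
  congr 1
  rw [Bool.eq_iff_iff, hiff]
  simp
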